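/- **Theorem.** Consider the unit-cost random access machine whose programs are built from assignments to registers and to array cells (with indirect addressing), sequencing, branching on (Boolean combinations of) comparisons, and while loops, whose memory consists of finitely many registers and finitely many unbounded arrays of natural numbers, and whose arithmetic operations on natural numbers are $x\mapsto x+1$ and $x\mapsto\max(x-1,0)$. There are a program $P$ of this machine and a constant $C$ such that the following holds for every finite simple undirected graph $G$ with vertices $0,\dots,n-1$ and $m$ edges that does not contain $P_4$ (the path on four vertices) as a not necessarily induced subgraph, and for every (not necessarily proper) edge-coloring $\varphi:E(G)\to\mathbb N$. Let the input consist of $n$, $m$ and a list of the edges of $G$, each listed exactly once, in any order, with its two endvertices and its color; all memory cells not holding input are initially zero. Then $P$ halts after at most $C\cdot\max(1,m)^{3/2}$ steps, and its output is the characteristic vector, with respect to the list, of the edge set of a largest rainbow matching of $G$, that is, of a matching with pairwise differently colored edges that has the largest possible number of edges. In short, Max Rainbow Matching is solvable in time $O(m^{3/2})$ on graphs without a (not necessarily induced) $P_4$ subgraph. -/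

import Mathlib

namespace RainbowMatching

section Graphs

variable {V K : Type*} {G : SimpleGraph V}

/-- A matching `M` of `G` is rainbow for the edge-coloring `φ` if distinct edges of `M` have
distinct colors. The coloring need not be proper. -/
def IsRainbowMatching (φ : G.EdgeLabeling K) (M : G.Subgraph) : Prop :=
  M.IsMatching ∧ Set.InjOn φ {e : G.edgeSet | (e : Sym2 V) ∈ M.edgeSet}

/-- A rainbow matching with the largest possible number of edges. -/
def IsMaxRainbowMatching (φ : G.EdgeLabeling K) (M : G.Subgraph) : Prop :=
  IsRainbowMatching φ M ∧
    ∀ M' : G.Subgraph, IsRainbowMatching φ M' → M'.edgeSet.ncard ≤ M.edgeSet.ncard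

end Graphs

/-! ### Random access machine

Programs are fixed finite texts over registers and arrays of natural numbers (finitely many of
each occur in a program), with indirect addressing, unit cost for every operation, and all cells
that hold no input equal to zero at the start. The only arithmetic is `+ 1` and `- 1`, so numbers
computed in `t` steps exceed the largest number in the input or in the program text by at most
`t`: words of logarithmic length suffice and unit cost is not abused. Everything computed here
is computed by an ordinary unit-cost (word) RAM within a constant factor of the same time. -/

/-- Contents of the registers and of the arrays: `arr a i` is cell `i` of array `a`. -/
structure Store where
  reg : ℕ → ℕ
  arr : ℕ → ℕ → ℕ

/-- Store `v` in register `x`. -/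
def Store.setReg (s : Store) (x v : ℕ) : Store :=
  { s with reg := Function.update s.reg x v }

/-- Store `v` in cell `i` of array `a`. -/
def Store.setArr (s : Store) (a i v : ℕ) : Store :=
  { s with arr := Function.update s.arr a (Function.update (s.arr a) i v) }

/-- Expressions: constants, registers, array cells with a computed index, successor and
(truncated) predecessor. -/
inductive Expr where
  | const (c : ℕ)
  | reg (x : ℕ)
  | get (a : ℕ) (i : Expr)
  | succ (e : Expr)
  | pred (e : Expr)

/-- Value of an expression. -/
def Expr.eval (s : Store) : Expr → ℕ
  | .const c => c
  | .reg x => s.reg x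
  | .get a i => s.arr a (i.eval s)
  | .succ e => e.eval s + 1
  | .pred e => e.eval s - 1

/-- Cost of evaluating an expression: one for each constant, each access and each operation. -/
def Expr.cost : Expr → ℕ
  | .const _ => 1
  | .reg _ => 1
  | .get _ i => i.cost + 1
  | .succ e => e.cost + 1
  | .pred e => e.cost + 1

/-- Tests: comparisons of two expressions and their Boolean combinations. -/
inductive Test where
  | eq (e f : Expr)
  | lt (e f : Expr)
  | neg (b : Test)
  | conj (b c : Test)
  | disj (b c : Test)

/-- Truth value of a test. -/
def Test.eval (s : Store) : Test → Bool
  | .eq e f => decide (e.eval s = f.eval s)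
  | .lt e f => decide (e.eval s < f.eval s)
  | .neg b => !b.eval s
  | .conj b c => b.eval s && c.eval s
  | .disj b c => b.eval s || c.eval s

/-- Cost of a test (both sides of a Boolean connective are always evaluated and paid for). -/
def Test.cost : Test → ℕ
  | .eq e f => e.cost + f.cost + 1
  | .lt e f => e.cost + f.cost + 1
  | .neg b => b.cost + 1
  | .conj b c => b.cost + c.cost + 1
  | .disj b c => b.cost + c.cost + 1

/-- Programs: empty program, `x := e`, `a[i] := e`, sequencing, branching and while loops. -/
inductive Program where
  | skip
  | assign (x : ℕ) (e : Expr)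
  | write (a : ℕ) (i e : Expr)
  | seq (p q : Program)
  | cond (b : Test) (p q : Program)
  | loop (b : Test) (p : Program)

/-- `Runs p s s' t`: started in the store `s`, the program `p` halts in the store `s'` after
exactly `t` steps. (The semantics is deterministic: `s'` and `t` are determined by `p`, `s`.) -/
inductive Runs : Program → Store → Store → ℕ → Prop where
  | skip (s : Store) : Runs .skip s s 1
  | assign (x : ℕ) (e : Expr) (s : Store) :
      Runs (.assign x e) s (s.setReg x (e.eval s)) (e.cost + 1)
  | write (a : ℕ) (i e : Expr) (s : Store) :
      Runs (.write a i e) s (s.setArr a (i.eval s) (e.eval s)) (i.cost + e.cost + 1)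
  | seq {p q : Program} {s s₁ s₂ : Store} {t₁ t₂ : ℕ} :
      Runs p s s₁ t₁ → Runs q s₁ s₂ t₂ → Runs (.seq p q) s s₂ (t₁ + t₂)
  | cond_true {b : Test} {p q : Program} {s s' : Store} {t : ℕ} :
      b.eval s = true → Runs p s s' t → Runs (.cond b p q) s s' (b.cost + t)
  | cond_false {b : Test} {p q : Program} {s s' : Store} {t : ℕ} :
      b.eval s = false → Runs q s s' t → Runs (.cond b p q) s s' (b.cost + t)
  | loop_true {b : Test} {p : Program} {s s₁ s₂ : Store} {t₁ t₂ : ℕ} :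
      b.eval s = true → Runs p s s₁ t₁ → Runs (.loop b p) s₁ s₂ t₂ →
      Runs (.loop b p) s s₂ (b.cost + t₁ + t₂)
  | loop_false {b : Test} {p : Program} {s : Store} :
      b.eval s = false → Runs (.loop b p) s s b.cost

/-! ### Encoding of instances and reading of the output -/

/-- A list of the edges of `G`, in any order, each edge once and written with its two endvertices
in any order. -/
structure EdgeListing {n : ℕ} (G : SimpleGraph (Fin n)) where
  fst : Fin G.edgeSet.ncard → Fin n
  snd : Fin G.edgeSet.ncard → Fin n
  adj : ∀ i, G.Adj (fst i) (snd i)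
  bijective : Function.Bijective fun i => (⟨s(fst i, snd i), adj i⟩ : G.edgeSet)

namespace EdgeListing

variable {n : ℕ} {G : SimpleGraph (Fin n)}

/-- The `i`-th edge of the list. -/
def edge (L : EdgeListing G) (i : Fin G.edgeSet.ncard) : G.edgeSet :=
  ⟨s(L.fst i, L.snd i), L.adj i⟩

/-- The input store for the graph `G` with edge-coloring `φ`: register `0` holds the number of
vertices, register `1` the number of edges, arrays `0` and `1` the endvertices of the edges, and
array `2` their colors. Everything else is zero. -/
noncomputable def input (L : EdgeListing G) (φ : G.EdgeLabeling ℕ) : Store where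
  reg x := if x = 0 then n else if x = 1 then G.edgeSet.ncard else 0
  arr a i :=
    if h : i < G.edgeSet.ncard then
      if a = 0 then (L.fst ⟨i, h⟩ : ℕ)
      else if a = 1 then (L.snd ⟨i, h⟩ : ℕ)
      else if a = 2 then φ (L.edge ⟨i, h⟩)
      else 0
    else 0

/-- The edge set output in a store: the edges whose entry in array `3` is `1`. -/
def output (L : EdgeListing G) (s : Store) : Set (Sym2 (Fin n)) :=
  {e | ∃ i : Fin G.edgeSet.ncard, s.arr 3 i = 1 ∧ (L.edge i : Sym2 (Fin n)) = e}

end EdgeListing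

end RainbowMatching

namespace RainbowMatching

/-! If no path on four vertices exists, having a common endvertex is a transitive relation on edges
(`exists_common_vertex`): every component with an edge is a star or a triangle, and a matching
contains at most one of its edges. Rainbow matchings of the graph are therefore the matchings of a
bipartite multigraph with the same m edges, whose left vertices are these components and whose right
vertices are the colors. A component is named by its first edge in the list, so a single pass over
the list builds this multigraph (`Prep.step`).

A maximum matching of it is found in two stages. Let k = ⌊√m⌋ + 1, so m < k². First comes an
auction: a free left vertex goes cyclically through its edges, bids on each color the number of
times the edge has been examined, and gets the color if the bid exceeds its price, possibly
displacing the previous owner. No edge is examined more than k times, which costs O((m + 1)k) steps.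
Counters and prices form an approximate dual solution, so weak duality with slack
(`IsMate.card_mul_le`) yields k·D ≤ (k + 1)·N for the maximum D and the size N obtained
(`Auction.mul_card_le`). Since N ≤ m < k², it follows that D − N < k.

Second, at most k linear-time searches remain. Each one either finds an augmenting path
(`Augment.step`), or leaves behind a vertex cover as in Kőnig's theorem, which proves optimality
(`Search.card_le`).

On the machine side, each loop is controlled by an invariant and a decreasing potential
(`Computes.loop`); loop bodies are evaluated symbolically. -/

/-- The store reached by a loop-free program (loops are skipped). -/
def Program.exec : Program → Store → Store
  | .skip, s => s
  | .assign x e, s => s.setReg x (e.eval s)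
  | .write a i e, s => s.setArr a (i.eval s) (e.eval s)
  | .seq p q, s => q.exec (p.exec s)
  | .cond b p q, s => if b.eval s = true then p.exec s else q.exec s
  | .loop _ _, s => s

/-- Programs without loops. -/
def Program.loopFree : Program → Bool
  | .seq p q => p.loopFree && q.loopFree
  | .cond _ p q => p.loopFree && q.loopFree
  | .loop _ _ => false
  | _ => true

/-- An upper bound for the number of steps of a loop-free program. -/
def Program.maxCost : Program → ℕ
  | .skip => 1
  | .assign _ e => e.cost + 1
  | .write _ i e => i.cost + e.cost + 1
  | .seq p q => p.maxCost + q.maxCost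
  | .cond b p q => b.cost + max p.maxCost q.maxCost
  | .loop _ _ => 0

/-- The final store of a loop-free program is an explicit function of the initial one, so `simp` can
evaluate such a program; only loops need invariants. -/
theorem runs_exec (p : Program) (h : p.loopFree = true) (s : Store) :
    ∃ t, Runs p s (p.exec s) t ∧ t ≤ p.maxCost := by
  induction p generalizing s with
  | skip => exact ⟨_, .skip s, le_rfl⟩
  | assign x e => exact ⟨_, .assign x e s, le_rfl⟩
  | write a i e => exact ⟨_, .write a i e s, le_rfl⟩
  | seq p q hp hq =>
    simp only [Program.loopFree, Bool.and_eq_true] at h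
    obtain ⟨t₁, r₁, h₁⟩ := hp h.1 s
    obtain ⟨t₂, r₂, h₂⟩ := hq h.2 (p.exec s)
    exact ⟨_, .seq r₁ r₂, add_le_add h₁ h₂⟩
  | cond b p q hp hq =>
    simp only [Program.loopFree, Bool.and_eq_true] at h
    obtain ⟨t₁, r₁, h₁⟩ := hp h.1 s
    obtain ⟨t₂, r₂, h₂⟩ := hq h.2 s
    simp only [Program.exec, Program.maxCost]
    by_cases hb : b.eval s = true
    · exact ⟨_, by simpa [hb] using Runs.cond_true hb r₁, by grind⟩
    · exact ⟨_, by simpa [hb] using Runs.cond_false (by simpa using hb) r₂, by grind⟩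
  | loop b p => simp [Program.loopFree] at h

/-! ### Total correctness with time bounds -/

/-- `Computes p pre post T`: from every store satisfying `pre` the program `p` halts within `T`
steps in a store satisfying `post`. -/
def Computes (p : Program) (pre post : Store → Prop) (T : ℕ) : Prop :=
  ∀ s, pre s → ∃ s' t, Runs p s s' t ∧ post s' ∧ t ≤ T

theorem Computes.seq {p q : Program} {P Q R : Store → Prop} {T₁ T₂ : ℕ}
    (hp : Computes p P Q T₁) (hq : Computes q Q R T₂) : Computes (.seq p q) P R (T₁ + T₂) := by
  intro s hs
  obtain ⟨s₁, t₁, r₁, h₁, l₁⟩ := hp s hs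
  obtain ⟨s₂, t₂, r₂, h₂, l₂⟩ := hq s₁ h₁
  exact ⟨s₂, _, .seq r₁ r₂, h₂, add_le_add l₁ l₂⟩

theorem Computes.mono {p : Program} {P P' Q Q' : Store → Prop} {T T' : ℕ}
    (h : Computes p P Q T) (hP : ∀ s, P' s → P s) (hQ : ∀ s, Q s → Q' s) (hT : T ≤ T') :
    Computes p P' Q' T' := by
  intro s hs
  obtain ⟨s', t, r, h', l⟩ := h s (hP s hs)
  exact ⟨s', t, r, hQ _ h', l.trans hT⟩

theorem Computes.cond {p q : Program} {b : Test} {P R : Store → Prop} {T : ℕ}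
    (hp : Computes p (fun s => P s ∧ b.eval s = true) R T)
    (hq : Computes q (fun s => P s ∧ b.eval s = false) R T) :
    Computes (.cond b p q) P R (b.cost + T) := by
  intro s hs
  cases hb : b.eval s with
  | true =>
    obtain ⟨s', t, r, h', l⟩ := hp s ⟨hs, hb⟩
    exact ⟨s', _, .cond_true hb r, h', by omega⟩
  | false =>
    obtain ⟨s', t, r, h', l⟩ := hq s ⟨hs, hb⟩
    exact ⟨s', _, .cond_false hb r, h', by omega⟩

theorem Computes.exec {p : Program} {P Q : Store → Prop} (h : p.loopFree = true)
    (hQ : ∀ s, P s → Q (p.exec s)) : Computes p P Q p.maxCost := by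
  intro s hs
  obtain ⟨t, r, l⟩ := runs_exec p h s
  exact ⟨_, t, r, hQ s hs, l⟩

/-- A loop whose body keeps the invariant `I`, takes at most `B` steps and decreases `Φ`. -/
theorem Computes.loop {p : Program} {b : Test} {I : Store → Prop} (Φ : Store → ℕ) {B N : ℕ}
    (h : ∀ s, I s → b.eval s = true → ∃ s' t, Runs p s s' t ∧ (I s' ∧ Φ s' < Φ s) ∧ t ≤ B) :
    Computes (.loop b p) (fun s => I s ∧ Φ s ≤ N) (fun s => I s ∧ b.eval s = false)
      ((B + b.cost) * N + b.cost) := by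
  induction N with
  | zero =>
    rintro s ⟨hI, hΦ⟩
    cases hb : b.eval s with
    | true =>
      obtain ⟨s', t, -, ⟨-, h'⟩, -⟩ := h s hI hb
      omega
    | false => exact ⟨s, _, .loop_false hb, ⟨hI, hb⟩, by omega⟩
  | succ N ih =>
    rintro s ⟨hI, hΦ⟩
    cases hb : b.eval s with
    | true =>
      obtain ⟨s₁, t₁, r₁, ⟨h₁, h'⟩, l₁⟩ := h s hI hb
      obtain ⟨s₂, t₂, r₂, h₂, l₂⟩ := ih s₁ ⟨h₁, by omega⟩
      exact ⟨s₂, _, .loop_true hb r₁ r₂, h₂, by rw [mul_add]; omega⟩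
    | false => exact ⟨s, _, .loop_false hb, ⟨hI, hb⟩, by omega⟩

theorem Computes.loop_exec {p : Program} {b : Test} {I : Store → Prop} (Φ : Store → ℕ) {N : ℕ}
    (hp : p.loopFree = true)
    (h : ∀ s, I s → b.eval s = true → I (p.exec s) ∧ Φ (p.exec s) < Φ s) :
    Computes (.loop b p) (fun s => I s ∧ Φ s ≤ N) (fun s => I s ∧ b.eval s = false)
      ((p.maxCost + b.cost) * N + b.cost) := by
  refine Computes.loop Φ fun s hs hb => ?_
  obtain ⟨t, r, l⟩ := runs_exec p hp s
  exact ⟨_, t, r, h s hs hb, l⟩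

/-- Sequential composition of a list of programs. -/
def block : List Program → Program
  | [] => .skip
  | [p] => p
  | p :: q :: ps => .seq p (block (q :: ps))

/-! ### Bipartite matchings and weak duality -/

/-- `owner` and `mate` describe a matching in the bipartite multigraph with edges `1, …, m` between
left vertices `l e` and colors `c e`: they give the matching edge at a color and at a left vertex,
and `0` where there is none. -/
structure IsMate (m : ℕ) (l c owner mate : ℕ → ℕ) : Prop where
  owner_spec : ∀ x, owner x ≠ 0 →
    owner x ≤ m ∧ c (owner x) = x ∧ mate (l (owner x)) = owner x
  mate_spec : ∀ u, mate u ≠ 0 →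
    mate u ≤ m ∧ l (mate u) = u ∧ owner (c (mate u)) = mate u

/-- The edges of the matching described by `owner`. -/
def matched (m : ℕ) (c owner : ℕ → ℕ) : Finset ℕ :=
  (Finset.Icc 1 m).filter fun e => owner (c e) = e

theorem mem_matched {m : ℕ} {c owner : ℕ → ℕ} {e : ℕ} :
    e ∈ matched m c owner ↔ (1 ≤ e ∧ e ≤ m) ∧ owner (c e) = e := by
  simp [matched]

namespace IsMate

variable {m : ℕ} {l c owner mate : ℕ → ℕ}

/-- Left vertices and colors play the same role. This turns facts about one side into facts about
the other, and lets an augmentation use `steal` from the color side. -/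
theorem symm (h : IsMate m l c owner mate) : IsMate m c l mate owner :=
  ⟨h.mate_spec, h.owner_spec⟩

theorem matched_symm (h : IsMate m l c owner mate) : matched m l mate = matched m c owner := by
  have h1 := h.owner_spec
  have h2 := h.mate_spec
  ext e
  rw [mem_matched, mem_matched]
  grind

theorem injOn_left (h : IsMate m l c owner mate) :
    Set.InjOn l (matched m c owner : Set ℕ) := by
  rw [← h.matched_symm]
  intro a ha b hb hab
  simp only [Finset.mem_coe, mem_matched] at ha hb
  rw [← ha.2, ← hb.2, hab]

theorem injOn_color (h : IsMate m l c owner mate) :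
    Set.InjOn c (matched m c owner : Set ℕ) := by
  have := h.symm.injOn_left
  rwa [h.matched_symm] at this

/-- Weak linear programming duality for matchings, with slack. -/
theorem card_mul_le (h : IsMate m l c owner mate) (π p : ℕ → ℕ) (k K : ℕ)
    (hk : ∀ e, 1 ≤ e → e ≤ m → k ≤ π (l e) + p (c e))
    (hK : ∀ e, 1 ≤ e → e ≤ m → owner (c e) = e → π (l e) + p (c e) ≤ K)
    (hπ : ∀ e, 1 ≤ e → e ≤ m → mate (l e) = 0 → π (l e) = 0)
    (hp : ∀ e, 1 ≤ e → e ≤ m → owner (c e) = 0 → p (c e) = 0)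
    {S : Finset ℕ} (hS : S ⊆ Finset.Icc 1 m) (hl : Set.InjOn l (S : Set ℕ))
    (hc : Set.InjOn c (S : Set ℕ)) :
    k * S.card ≤ K * (matched m c owner).card := by
  have hmem : ∀ e ∈ S, 1 ≤ e ∧ e ≤ m := fun e he => Finset.mem_Icc.1 (hS he)
  -- `S` uses each left vertex at most once, and `π` is nonzero only at left vertices that the
  -- current matching covers.
  have h1 : ∑ e ∈ S, π (l e) ≤ ∑ e ∈ matched m c owner, π (l e) := by
    rw [← Finset.sum_image hl, ← Finset.sum_image h.injOn_left]
    refine Finset.sum_le_sum_of_ne_zero fun u hu hne => ?_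
    obtain ⟨e, he, rfl⟩ := Finset.mem_image.1 hu
    have h0 : mate (l e) ≠ 0 := fun h0 => hne (hπ e (hmem e he).1 (hmem e he).2 h0)
    obtain ⟨ha, hb, hd⟩ := h.mate_spec _ h0
    exact Finset.mem_image.2 ⟨mate (l e), mem_matched.2 ⟨⟨by omega, ha⟩, hd⟩, hb⟩
  have h2 : ∑ e ∈ S, p (c e) ≤ ∑ e ∈ matched m c owner, p (c e) := by
    rw [← Finset.sum_image hc, ← Finset.sum_image h.injOn_color]
    refine Finset.sum_le_sum_of_ne_zero fun u hu hne => ?_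
    obtain ⟨e, he, rfl⟩ := Finset.mem_image.1 hu
    have h0 : owner (c e) ≠ 0 := fun h0 => hne (hp e (hmem e he).1 (hmem e he).2 h0)
    obtain ⟨ha, hb, hd⟩ := h.owner_spec _ h0
    exact Finset.mem_image.2 ⟨owner (c e), mem_matched.2 ⟨⟨by omega, ha⟩, by rw [hb]⟩, hb⟩
  calc k * S.card = ∑ e ∈ S, k := by simp [mul_comm]
    _ ≤ ∑ e ∈ S, (π (l e) + p (c e)) :=
        Finset.sum_le_sum fun e he => hk e (hmem e he).1 (hmem e he).2
    _ ≤ ∑ e ∈ matched m c owner, (π (l e) + p (c e)) := by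
        rw [Finset.sum_add_distrib, Finset.sum_add_distrib]; exact add_le_add h1 h2
    _ ≤ ∑ e ∈ matched m c owner, K := Finset.sum_le_sum fun e he => by
        obtain ⟨⟨ha, hb⟩, hd⟩ := mem_matched.1 he
        exact hK e ha hb hd
    _ = K * (matched m c owner).card := by simp [mul_comm]

/-- A free left vertex takes a free color. -/
theorem take (h : IsMate m l c owner mate) {e : ℕ} (he : 1 ≤ e) (hm : e ≤ m)
    (hu : mate (l e) = 0) (hc : owner (c e) = 0) :
    IsMate m l c (Function.update owner (c e) e) (Function.update mate (l e) e) ∧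
      (matched m c (Function.update owner (c e) e)).card = (matched m c owner).card + 1 := by
  have h1 := h.owner_spec
  have h2 := h.mate_spec
  refine ⟨⟨?_, ?_⟩, ?_⟩
  · intro x
    simp only [Function.update_apply]
    grind
  · intro x
    simp only [Function.update_apply]
    grind
  · have : matched m c (Function.update owner (c e) e) = insert e (matched m c owner) := by
      ext x
      simp only [mem_matched, Finset.mem_insert, Function.update_apply]
      grind
    rw [this, Finset.card_insert_of_notMem]
    rw [mem_matched]
    omega

/-- A free left vertex takes a color away from another left vertex. -/
theorem steal (h : IsMate m l c owner mate) {e : ℕ} (he : 1 ≤ e) (hm : e ≤ m)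
    (hu : mate (l e) = 0) (hc : owner (c e) ≠ 0) :
    IsMate m l c (Function.update owner (c e) e)
        (Function.update (Function.update mate (l (owner (c e))) 0) (l e) e) ∧
      (matched m c (Function.update owner (c e) e)).card = (matched m c owner).card := by
  have h1 := h.owner_spec
  have h2 := h.mate_spec
  refine ⟨⟨?_, ?_⟩, ?_⟩
  · intro x
    simp only [Function.update_apply]
    grind
  · intro x
    simp only [Function.update_apply]
    grind
  · have hold : owner (c e) ∈ matched m c owner := by
      obtain ⟨ha, hb, hd⟩ := h1 _ hc
      rw [mem_matched, hb]; omega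
    have : matched m c (Function.update owner (c e) e)
        = insert e ((matched m c owner).erase (owner (c e))) := by
      ext x
      simp only [mem_matched, Finset.mem_insert, Finset.mem_erase, Function.update_apply]
      grind
    rw [this, Finset.card_insert_of_notMem, Finset.card_erase_of_mem hold]
    · have := Finset.card_pos.2 ⟨_, hold⟩
      omega
    · simp only [mem_matched, Finset.mem_erase]
      grind

end IsMate

/-! ### Adjacency lists -/

/-- `head` and `nxt` represent, for every left vertex `u`, the decreasing list of the edges
`e ≤ m` with `l e = u`; the value `0` marks the end of a list. -/
structure Lists (m : ℕ) (l head nxt : ℕ → ℕ) : Prop where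
  left_mem : ∀ e, 1 ≤ e → e ≤ m → 1 ≤ l e ∧ l e ≤ m
  head_le : ∀ u, head u ≤ m
  head_left : ∀ u, head u ≠ 0 → l (head u) = u
  le_head : ∀ e, 1 ≤ e → e ≤ m → e ≤ head (l e)
  nxt_lt : ∀ e, 1 ≤ e → e ≤ m → nxt e < e
  nxt_left : ∀ e, 1 ≤ e → e ≤ m → nxt e ≠ 0 → l (nxt e) = l e
  le_nxt : ∀ e e', 1 ≤ e → e ≤ m → 1 ≤ e' → l e' = l e → e' < e → e' ≤ nxt e

/-- The new edge has the largest number, so putting it at the front keeps the list decreasing. -/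
theorem Lists.snoc {i u : ℕ} {l head nxt : ℕ → ℕ} (h : Lists i l head nxt) (hu : 1 ≤ u)
    (hui : u ≤ i + 1) :
    Lists (i + 1) (Function.update l (i + 1) u) (Function.update head u (i + 1))
      (Function.update nxt (i + 1) (head u)) := by
  obtain ⟨h1, h2, h3, h4, h5, h6, h7⟩ := h
  constructor
  · intro e he he'
    have := h1 e
    grind
  · intro v
    have := h2 v
    grind
  · intro v
    have h2' := h2 v
    have h3' := h3 v
    simp only [Function.update_apply]
    clear h1 h2 h3 h4 h5 h6 h7
    grind
  · intro e he he'
    have := h4 e he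
    simp only [Function.update_apply]
    clear h1 h2 h3 h4 h5 h6 h7
    grind
  · intro e he he'
    have := h5 e he
    have := h2 u
    simp only [Function.update_apply]
    clear h1 h2 h3 h4 h5 h6 h7
    grind
  · intro e he he'
    have := h6 e he
    have := h5 e he
    have := h2 u
    have := h3 u
    simp only [Function.update_apply]
    clear h1 h2 h3 h4 h5 h6 h7
    grind
  · intro e e' he he' hp
    have := h7 e e' he
    have := h4 e' hp
    simp only [Function.update_apply]
    clear h1 h2 h3 h4 h5 h6 h7
    grind

/-! ### The auction -/

/-- Invariant of the auction: left vertex `act` (if not `0`) is bidding, the left vertices `≤ i`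
have been started. Every color has a `price`, edge `e` has been examined `cnt e` times, and `cur u`
is the next edge to be examined at `u`. If `f ≠ 0`, then edge `f` has been examined without
adjusting the price of its color. -/
structure Auction (m k : ℕ) (l c head cnt price owner mate cur : ℕ → ℕ) (i act f : ℕ) :
    Prop where
  isMate : IsMate m l c owner mate
  cur_le : ∀ u, cur u ≤ m
  cur_left : ∀ u, cur u ≠ 0 → l (cur u) = u
  cur_ne : ∀ u, head u ≠ 0 → cur u ≠ 0
  -- Lists are decreasing, so the edges above the cursor are those already examined in the current
  -- round; the counters at one left vertex differ by at most one.
  cnt_eq : ∀ e, 1 ≤ e → e ≤ m → cnt e = cnt (cur (l e)) + if cur (l e) < e then 1 else 0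
  cnt_le : ∀ e, 1 ≤ e → e ≤ m → cnt e ≤ k
  cnt_price : ∀ e, 1 ≤ e → e ≤ m → e ≠ f → cnt e ≤ price (c e)
  price_free : ∀ x, owner x = 0 → price x = 0
  price_owned : ∀ x, owner x ≠ 0 → price x ≤ cnt (owner x)
  done : ∀ u, 1 ≤ u → u ≤ i → u ≠ act → head u ≠ 0 → mate u = 0 → k ≤ cnt (cur u)
  fresh : ∀ u, i < u → mate u = 0
  le : i ≤ m
  act_le : act ≤ i
  act_free : act ≠ 0 → mate act = 0
  act_head : act ≠ 0 → head act ≠ 0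

namespace Auction

variable {m k : ℕ} {l c head nxt cnt price owner mate cur : ℕ → ℕ} {i act f : ℕ}

theorem init (h : Lists m l head nxt) :
    Auction m k l c head (fun _ => 0) (fun _ => 0) (fun _ => 0) (fun _ => 0) head 0 0 0 where
  isMate := ⟨by simp, by simp⟩
  cur_le := h.head_le
  cur_left := h.head_left
  cur_ne := fun _ h => h
  cnt_eq := fun e he hm => by
    have := h.le_head e he hm
    simp [this]
  cnt_le := by simp
  cnt_price := by simp
  price_free := by simp
  price_owned := by simp
  done := by omega
  fresh := by simp
  le := by simp
  act_le := le_rfl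
  act_free := by simp
  act_head := by simp

theorem activate (h : Auction m k l c head cnt price owner mate cur i 0 0) (hi : i < m)
    (h0 : head (i + 1) ≠ 0) :
    Auction m k l c head cnt price owner mate cur (i + 1) (i + 1) 0 :=
  { h with
    done := fun u h1 h2 h3 => h.done u h1 (by omega) (by omega)
    fresh := fun u h1 => h.fresh u (by omega)
    le := hi
    act_le := le_rfl
    act_free := fun _ => h.fresh _ (by omega)
    act_head := fun _ => h0 }

/-- A left vertex without edges need not bid, and `done` asks nothing of it. -/
theorem pass (h : Auction m k l c head cnt price owner mate cur i 0 0) (hi : i < m)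
    (h0 : head (i + 1) = 0) :
    Auction m k l c head cnt price owner mate cur (i + 1) 0 0 :=
  { h with
    done := fun u h1 h2 h3 h4 => h.done u h1
      (by rcases Nat.lt_or_ge i u with h | h
          · obtain rfl : u = i + 1 := by omega
            exact absurd h0 h4
          · exact h) (by omega) h4
    fresh := fun u h1 => h.fresh u (by omega)
    le := hi
    act_le := by omega
    act_free := by simp
    act_head := by simp }

/-- By `cnt_eq` and `cnt_le` every edge of the active vertex has now been examined exactly `k`
times: the vertex gives up for good. -/
theorem drop (h : Auction m k l c head cnt price owner mate cur i act 0)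
    (h0 : k ≤ cnt (cur act)) :
    Auction m k l c head cnt price owner mate cur i 0 0 :=
  { h with
    done := fun u h1 h2 h3 h4 h5 => by
      by_cases hu : u = act
      · rwa [hu]
      · exact h.done u h1 h2 hu h4 h5
    act_le := by omega
    act_free := by simp
    act_head := by simp }

theorem cur_pos (h : Auction m k l c head cnt price owner mate cur i act f) (ha : act ≠ 0) :
    1 ≤ cur act ∧ cur act ≤ m ∧ l (cur act) = act := by
  have := h.cur_ne _ (h.act_head ha)
  exact ⟨by omega, h.cur_le _, h.cur_left _ this⟩

/-- Examining an edge without changing the matching and the prices. -/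
theorem advance (hL : Lists m l head nxt)
    (h : Auction m k l c head cnt price owner mate cur i act 0) (ha : act ≠ 0)
    (hk : cnt (cur act) < k) {nc : ℕ}
    (hnc : nc = if nxt (cur act) = 0 then head act else nxt (cur act)) :
    Auction m k l c head (Function.update cnt (cur act) (cnt (cur act) + 1)) price owner mate
      (Function.update cur act nc) i act (cur act) := by
  obtain ⟨he1, he2, he3⟩ := h.cur_pos ha
  have hnc0 : nc ≠ 0 := by
    have := h.act_head ha
    grind
  have hncl : l nc = act := by
    have h1 := hL.nxt_left (cur act) he1 he2
    have h2 := hL.head_left act (h.act_head ha)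
    grind
  have hncm : nc ≤ m := by
    have h1 := hL.nxt_lt (cur act) he1 he2
    have h2 := hL.head_le act
    grind
  -- If the cursor wraps around, the round is complete and the head has one examination more than
  -- the old cursor had; otherwise the next edge has not had its turn in this round and its counter
  -- equals the old one.
  have hncc : Function.update cnt (cur act) (cnt (cur act) + 1) nc =
      cnt (cur act) + if nxt (cur act) = 0 then 1 else 0 := by
    have h1 := h.cnt_eq nc (by omega) hncm
    have h2 := hL.le_nxt nc
    have h3 := hL.le_head (cur act) he1 he2
    have h4 := hL.nxt_lt (cur act) he1 he2
    rw [hncl] at h1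
    rw [he3] at h3
    simp only [Function.update_apply]
    grind
  refine { h with
    cur_le := ?_, cur_left := ?_, cur_ne := ?_, cnt_eq := ?_, cnt_le := ?_, cnt_price := ?_,
    price_owned := ?_, done := ?_ }
  · intro u
    have := h.cur_le u
    simp only [Function.update_apply]
    grind
  · intro u
    have := h.cur_left u
    simp only [Function.update_apply]
    grind
  · intro u
    have := h.cur_ne u
    simp only [Function.update_apply]
    grind
  · intro e h1 h2
    have h3 := h.cnt_eq e h1 h2
    by_cases hu : l e = act
    · rw [hu, Function.update_self, hncc]
      rw [hu] at h3
      have h4 := hL.le_nxt (cur act) e he1 he2 h1 (hu.trans he3.symm)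
      have h5 := hL.nxt_lt (cur act) he1 he2
      have h6 := hL.le_head e h1 h2
      rw [hu] at h6
      simp only [Function.update_apply]
      clear hncc
      grind
    -- Cursors of other left vertices point to other edges, whose counters are untouched.
    · have h4 : cur (l e) ≠ cur act := fun h4 => by
        by_cases h5 : cur (l e) = 0
        · omega
        · exact hu (by rw [← h.cur_left _ h5, h4, he3])
      have h5 : e ≠ cur act := fun h5 => hu (by rw [h5, he3])
      rw [Function.update_of_ne h5, Function.update_of_ne hu, Function.update_of_ne h4, h3]
  · intro e h1 h2
    have := h.cnt_le e h1 h2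
    simp only [Function.update_apply]
    grind
  · intro e h1 h2 h3
    rw [Function.update_of_ne h3]
    exact h.cnt_price e h1 h2 (by omega)
  · intro x hx
    have := h.price_owned x hx
    simp only [Function.update_apply]
    grind
  · intro u h1 h2 h3 h4 h5
    have := h.done u h1 h2 h3 h4 h5
    rw [Function.update_of_ne h3]
    simp only [Function.update_apply]
    grind

/-- The bid does not exceed the price, so the exceptional edge already satisfies the price
condition. -/
theorem settle {e : ℕ} (h : Auction m k l c head cnt price owner mate cur i act e)
    (he : cnt e ≤ price (c e)) : Auction m k l c head cnt price owner mate cur i act 0 :=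
  { h with
    cnt_price := fun x h1 h2 _ => by
      by_cases hx : x = e
      · rwa [hx]
      · exact h.cnt_price x h1 h2 hx }

/-- The active left vertex takes a free color. -/
theorem take {e : ℕ} (h : Auction m k l c head cnt price owner mate cur i act e) (ha : act ≠ 0)
    (he : 1 ≤ e) (hm : e ≤ m) (hl : l e = act) (hp : price (c e) ≤ cnt e) (hc : owner (c e) = 0) :
    Auction m k l c head cnt (Function.update price (c e) (cnt e))
      (Function.update owner (c e) e) (Function.update mate act e) cur i 0 0 := by
  have hM := (h.isMate.take he hm (hl ▸ h.act_free ha) hc).1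
  rw [hl] at hM
  refine { h with
    isMate := hM
    act_le := by omega
    act_free := by simp
    act_head := by simp
    cnt_price := ?_, price_free := ?_, price_owned := ?_, done := ?_, fresh := ?_ }
  · intro x h1 h2 _
    have := h.cnt_price x h1 h2
    simp only [Function.update_apply]
    grind
  · intro x
    have := h.price_free x
    simp only [Function.update_apply]
    grind
  · intro x
    have := h.price_owned x
    simp only [Function.update_apply]
    grind
  · intro u h1 h2 h3
    have := h.done u h1 h2
    simp only [Function.update_apply]
    grind
  · intro u h1
    have := h.fresh u h1
    have := h.act_le
    simp only [Function.update_apply]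
    grind

/-- The active left vertex takes a color away from another left vertex, which becomes active. -/
theorem steal {e : ℕ} (hL : Lists m l head nxt)
    (h : Auction m k l c head cnt price owner mate cur i act e) (ha : act ≠ 0)
    (he : 1 ≤ e) (hm : e ≤ m) (hl : l e = act) (hp : price (c e) ≤ cnt e) (hc : owner (c e) ≠ 0) :
    Auction m k l c head cnt (Function.update price (c e) (cnt e))
      (Function.update owner (c e) e)
      (Function.update (Function.update mate (l (owner (c e))) 0) act e) cur i
      (l (owner (c e))) 0 := by
  have hM := (h.isMate.steal he hm (hl ▸ h.act_free ha) hc).1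
  rw [hl] at hM
  obtain ⟨o1, o2, o3⟩ := h.isMate.owner_spec _ hc
  have o4 := hL.le_head (owner (c e)) (by omega) o1
  have o5 := h.act_free ha
  -- The displaced vertex is matched, hence already started; so it may become the active one.
  have o6 := h.fresh (l (owner (c e)))
  have o7 := h.act_le
  refine { h with
    isMate := hM
    act_le := by grind
    act_head := fun _ => by omega,
    cnt_price := ?_, price_free := ?_, price_owned := ?_, done := ?_, fresh := ?_,
    act_free := ?_ }
  · intro x h1 h2 _
    have := h.cnt_price x h1 h2
    simp only [Function.update_apply]
    grind
  · intro x
    have := h.price_free x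
    simp only [Function.update_apply]
    grind
  · intro x
    have := h.price_owned x
    simp only [Function.update_apply]
    grind
  · intro u h1 h2 h3
    have := h.done u h1 h2
    simp only [Function.update_apply]
    grind
  · intro u h1
    have := h.fresh u h1
    simp only [Function.update_apply]
    grind
  · intro _
    simp only [Function.update_apply]
    grind

/-- At the end of the auction the matching is almost as large as possible. -/
theorem mul_card_le (hL : Lists m l head nxt)
    (h : Auction m k l c head cnt price owner mate cur m 0 0)
    {S : Finset ℕ} (hS : S ⊆ Finset.Icc 1 m) (hl : Set.InjOn l (S : Set ℕ))
    (hc : Set.InjOn c (S : Set ℕ)) : k * S.card ≤ (k + 1) * (matched m c owner).card := by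
  -- Dual solution: the utility `k - cnt (cur u)` at left vertices and the prices at colors. Every
  -- edge has total at least `k` because `cnt (cur u) ≤ cnt e ≤ price (c e)`. A matched edge has
  -- total at most `k + 1` because its price is at most `cnt e ≤ cnt (cur u) + 1`. Free left
  -- vertices have given up, so their utility is zero.
  refine h.isMate.card_mul_le (fun u => k - cnt (cur u)) price k (k + 1) ?_ ?_ ?_ ?_ hS hl hc
  · intro e h1 h2
    have h3 := h.cnt_eq e h1 h2
    have h4 := h.cnt_price e h1 h2 (by omega)
    omega
  · intro e h1 h2 h3
    have h4 := h.cnt_eq e h1 h2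
    have h5 := h.price_owned (c e) (by omega)
    have h6 := h.cnt_le e h1 h2
    rw [h3] at h5
    split_ifs at h4 <;> omega
  · intro e h1 h2 h3
    have h4 := hL.left_mem e h1 h2
    have h5 := hL.le_head e h1 h2
    have := h.done (l e) h4.1 h4.2 (by omega) (by omega) h3
    omega
  · intro e h1 h2 h3
    exact h.price_free _ h3

end Auction

/-! ### The search for an augmenting path -/

/-- `u` has been scanned completely, or waits in the queue. -/
def Pending (cur Q : ℕ → ℕ) (qh qt u : ℕ) : Prop :=
  cur u = 0 ∨ ∃ j, qh ≤ j ∧ j < qt ∧ Q j = u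

/-- Number of the edges that have not been scanned. -/
def unscanned (m : ℕ) (l cur : ℕ → ℕ) : ℕ :=
  ((Finset.Icc 1 m).filter fun e => e ≤ cur (l e)).card

theorem unscanned_le (m : ℕ) (l cur : ℕ → ℕ) : unscanned m l cur ≤ m := by
  refine (Finset.card_filter_le _ _).trans ?_
  simp

/-- By `le_nxt` no edge of `u` lies strictly between the cursor and its successor, so exactly one
edge is consumed. -/
theorem unscanned_update {m : ℕ} {l head nxt cur : ℕ → ℕ} (hL : Lists m l head nxt) {u : ℕ}
    (h0 : cur u ≠ 0) (hm : cur u ≤ m) (hl : l (cur u) = u) :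
    unscanned m l (Function.update cur u (nxt (cur u))) + 1 = unscanned m l cur := by
  have : (Finset.Icc 1 m).filter (fun e => e ≤ cur (l e)) = insert (cur u)
      ((Finset.Icc 1 m).filter fun e => e ≤ Function.update cur u (nxt (cur u)) (l e)) := by
    ext e
    simp only [Finset.mem_insert, Finset.mem_filter, Finset.mem_Icc, Function.update_apply]
    have h1 := hL.nxt_lt (cur u) (by omega) hm
    have h2 := hL.le_nxt (cur u) e (by omega) hm
    grind
  unfold unscanned
  rw [this, Finset.card_insert_of_notMem]
  simp only [Finset.mem_filter, Finset.mem_Icc, Function.update_apply, hl]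
  have h1 := hL.nxt_lt (cur u) (by omega) hm
  simp only [if_true]
  omega

/-- The parent of the visited color `x` leads to a free left vertex or to a color visited
earlier. -/
def ParentOK (m T0 : ℕ) (l c mate vis par : ℕ → ℕ) (x : ℕ) : Prop :=
  1 ≤ par x ∧ par x ≤ m ∧ c (par x) = x ∧ (mate (l (par x)) = 0 ∨
    (T0 < vis (c (mate (l (par x)))) ∧ vis (c (mate (l (par x)))) < vis x))

/-- Invariant of the search: the colors with `T0 < vis x` have been visited, in the order of
`vis`; entries `qh, …, qt - 1` of `Q` are the left vertices to be scanned, `cur u` is the next edge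
to be scanned at `u`, and `fnd` is `x + 1` once a free color `x` is visited. -/
structure Search (m T0 : ℕ) (l c owner mate cur vis par Q : ℕ → ℕ) (T qh qt fnd : ℕ) :
    Prop where
  isMate : IsMate m l c owner mate
  cur_le : ∀ u, cur u ≤ m
  cur_left : ∀ u, cur u ≠ 0 → l (cur u) = u
  queue : ∀ j, qh ≤ j → j < qt → mate (Q j) = 0 ∨ T0 < vis (c (mate (Q j)))
  scanned : ∀ e, 1 ≤ e → e ≤ m → cur (l e) < e → T0 < vis (c e)
  free : ∀ u, 1 ≤ u → u ≤ m → mate u = 0 → Pending cur Q qh qt u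
  visited : ∀ x, T0 < vis x → owner x ≠ 0 → Pending cur Q qh qt (l (owner x))
  vis_le : ∀ x, vis x ≤ T
  parent : ∀ x, T0 < vis x → ParentOK m T0 l c mate vis par x
  found : ∀ x, T0 < vis x → owner x = 0 → fnd = x + 1
  found_vis : fnd ≠ 0 → T0 < vis (fnd - 1)
  found_free : fnd ≠ 0 → owner (fnd - 1) = 0
  budget : T + unscanned m l cur ≤ T0 + m
  le : T0 ≤ T

namespace Search

variable {m T0 : ℕ} {l c head nxt owner mate cur vis par Q : ℕ → ℕ} {T qh qt fnd : ℕ}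

/-- The vertex leaving the queue has an exhausted list, so it stays `Pending` by the other
alternative. -/
theorem pop (h : Search m T0 l c owner mate cur vis par Q T qh qt fnd) (h0 : cur (Q qh) = 0) :
    Search m T0 l c owner mate cur vis par Q T (qh + 1) qt fnd := by
  have key : ∀ u, Pending cur Q qh qt u → Pending cur Q (qh + 1) qt u := by
    rintro u (hu | ⟨j, h1, h2, h3⟩)
    · exact .inl hu
    · rcases h1.eq_or_lt with rfl | h1
      · exact .inl (h3 ▸ h0)
      · exact .inr ⟨j, h1, h2, h3⟩
  exact { h with
    queue := fun j h1 => h.queue j (by omega)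
    free := fun u h1 h2 h3 => key _ (h.free u h1 h2 h3)
    visited := fun u h1 h2 => key _ (h.visited u h1 h2) }

/-- The vertex being scanned remains at the front of the queue, so moving its cursor harms nothing.
-/
theorem pending_update (hq : qh < qt) (v : ℕ) {u : ℕ} (h : Pending cur Q qh qt u) :
    Pending (Function.update cur (Q qh) v) Q qh qt u := by
  by_cases hu : u = Q qh
  · exact .inr ⟨qh, le_rfl, hq, hu.symm⟩
  · rcases h with h | h
    · exact .inl (by rwa [Function.update_of_ne hu])
    · exact .inr h

theorem pending_push (w : ℕ) {u : ℕ} (h : Pending cur Q qh qt u) :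
    Pending cur (Function.update Q qt w) qh (qt + 1) u := by
  rcases h with h | ⟨j, h1, h2, h3⟩
  · exact .inl h
  · exact .inr ⟨j, h1, by omega, by rwa [Function.update_of_ne (by omega)]⟩

theorem cur_update (hL : Lists m l head nxt)
    (h : Search m T0 l c owner mate cur vis par Q T qh qt fnd) (h0 : cur (Q qh) ≠ 0) :
    (∀ u, Function.update cur (Q qh) (nxt (cur (Q qh))) u ≤ m) ∧
    (∀ u, Function.update cur (Q qh) (nxt (cur (Q qh))) u ≠ 0 →
      l (Function.update cur (Q qh) (nxt (cur (Q qh))) u) = u) ∧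
    (∀ e, 1 ≤ e → e ≤ m → Function.update cur (Q qh) (nxt (cur (Q qh))) (l e) < e →
      e = cur (Q qh) ∨ cur (l e) < e) := by
  have h1 := h.cur_le (Q qh)
  have h2 := h.cur_left _ h0
  have h3 := hL.nxt_lt (cur (Q qh)) (by omega) h1
  have h4 := hL.nxt_left (cur (Q qh)) (by omega) h1
  refine ⟨fun u => ?_, fun u => ?_, fun e he hm => ?_⟩
  · have := h.cur_le u
    simp only [Function.update_apply]
    grind
  · have := h.cur_left u
    simp only [Function.update_apply]
    grind
  · have := hL.le_nxt (cur (Q qh)) e (by omega) h1 he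
    simp only [Function.update_apply]
    grind

theorem skip (hL : Lists m l head nxt)
    (h : Search m T0 l c owner mate cur vis par Q T qh qt fnd) (hq : qh < qt)
    (h0 : cur (Q qh) ≠ 0) (hv : T0 < vis (c (cur (Q qh)))) :
    Search m T0 l c owner mate (Function.update cur (Q qh) (nxt (cur (Q qh)))) vis par Q
      T qh qt fnd := by
  obtain ⟨h1, h2, h3⟩ := h.cur_update hL h0
  have hU := unscanned_update hL h0 (h.cur_le _) (h.cur_left _ h0)
  have := h.budget
  exact { h with
    cur_le := h1
    cur_left := h2
    scanned := fun e he hm hs => by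
      rcases h3 e he hm hs with rfl | h4
      · exact hv
      · exact h.scanned e he hm h4
    free := fun u h1 h2 h3 => pending_update hq _ (h.free u h1 h2 h3)
    visited := fun u h1 h2 => pending_update hq _ (h.visited u h1 h2)
    budget := by omega }

/-- The new stamp `T + 1` exceeds all older ones. The new color leads back to an older color or to a
free left vertex, and the older parents never refer to the new color. -/
theorem parentOK_visit (h : Search m T0 l c owner mate cur vis par Q T qh qt fnd) (hq : qh < qt)
    (h0 : cur (Q qh) ≠ 0) (hv : vis (c (cur (Q qh))) ≤ T0) (x : ℕ)
    (hx : T0 < Function.update vis (c (cur (Q qh))) (T + 1) x) :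
    ParentOK m T0 l c mate (Function.update vis (c (cur (Q qh))) (T + 1))
      (Function.update par (c (cur (Q qh))) (cur (Q qh))) x := by
  have hle := h.le
  by_cases hxe : x = c (cur (Q qh))
  · subst hxe
    refine ⟨?_, ?_, ?_, ?_⟩
    · rw [Function.update_self]; omega
    · rw [Function.update_self]; exact h.cur_le _
    · rw [Function.update_self]
    · rw [Function.update_self, h.cur_left _ h0, Function.update_self]
      refine (h.queue qh le_rfl hq).imp id fun h1 => ?_
      have := h.vis_le (c (mate (Q qh)))
      rw [Function.update_of_ne (fun h2 => by rw [h2] at h1; omega)]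
      exact ⟨h1, by omega⟩
  · rw [Function.update_of_ne hxe] at hx
    obtain ⟨h1, h2, h3, h4⟩ := h.parent x hx
    unfold ParentOK
    simp only [Function.update_of_ne hxe]
    refine ⟨h1, h2, h3, h4.imp id fun ⟨h5, h6⟩ => ?_⟩
    rw [Function.update_of_ne (fun h2 => by rw [h2] at h5; omega)]
    exact ⟨h5, h6⟩

theorem visit_free (hL : Lists m l head nxt)
    (h : Search m T0 l c owner mate cur vis par Q T qh qt 0) (hq : qh < qt)
    (h0 : cur (Q qh) ≠ 0) (hv : vis (c (cur (Q qh))) ≤ T0) (ho : owner (c (cur (Q qh))) = 0) :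
    Search m T0 l c owner mate (Function.update cur (Q qh) (nxt (cur (Q qh))))
      (Function.update vis (c (cur (Q qh))) (T + 1))
      (Function.update par (c (cur (Q qh))) (cur (Q qh))) Q (T + 1) qh qt
      (c (cur (Q qh)) + 1) := by
  obtain ⟨h1, h2, h3⟩ := h.cur_update hL h0
  have hU := unscanned_update hL h0 (h.cur_le _) (h.cur_left _ h0)
  have hb := h.budget
  have hle := h.le
  refine { h with
    cur_le := h1
    cur_left := h2
    budget := by omega
    le := by omega
    queue := ?_, scanned := ?_, free := ?_, visited := ?_, vis_le := ?_,
    parent := ?_, found := ?_, found_vis := ?_, found_free := ?_ }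
  · intro j hj1 hj2
    have := h.queue j hj1 hj2
    simp only [Function.update_apply]
    grind
  · intro e he hm hs
    have h4 := h3 e he hm hs
    have h5 := h.scanned e he hm
    simp only [Function.update_apply]
    grind
  · exact fun u h1 h2 h3 => pending_update hq _ (h.free u h1 h2 h3)
  · intro x hx hox
    -- The newly visited color has no owner, so no left vertex has to be queued.
    rw [Function.update_of_ne (by rintro rfl; exact hox ho)] at hx
    exact pending_update hq _ (h.visited x hx hox)
  · intro x
    have := h.vis_le x
    simp only [Function.update_apply]
    grind
  · exact h.parentOK_visit hq h0 hv
  · intro x hx hox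
    by_cases hxe : x = c (cur (Q qh))
    · rw [hxe]
    · rw [Function.update_of_ne hxe] at hx
      have := h.found x hx hox
      omega
  · intro _
    simp only [Nat.add_sub_cancel, Function.update_self]
    omega
  · intro _
    simpa using ho

theorem visit_owned (hL : Lists m l head nxt)
    (h : Search m T0 l c owner mate cur vis par Q T qh qt 0) (hq : qh < qt)
    (h0 : cur (Q qh) ≠ 0) (hv : vis (c (cur (Q qh))) ≤ T0) (ho : owner (c (cur (Q qh))) ≠ 0) :
    Search m T0 l c owner mate (Function.update cur (Q qh) (nxt (cur (Q qh))))
      (Function.update vis (c (cur (Q qh))) (T + 1))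
      (Function.update par (c (cur (Q qh))) (cur (Q qh)))
      (Function.update Q qt (l (owner (c (cur (Q qh)))))) (T + 1) qh (qt + 1) 0 := by
  obtain ⟨h1, h2, h3⟩ := h.cur_update hL h0
  have hU := unscanned_update hL h0 (h.cur_le _) (h.cur_left _ h0)
  have hb := h.budget
  have hle := h.le
  refine { h with
    cur_le := h1
    cur_left := h2
    budget := by omega
    le := by omega
    queue := ?_, scanned := ?_, free := ?_, visited := ?_, vis_le := ?_,
    parent := ?_, found := ?_, found_vis := ?_, found_free := ?_ }
  · intro j hj1 hj2
    by_cases hj : j = qt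
    · subst hj
      -- The queued vertex is the owner's left end; its matched color is the one just visited.
      obtain ⟨-, h5, h6⟩ := h.isMate.owner_spec _ ho
      right
      rw [Function.update_self, h6, h5, Function.update_self]
      omega
    · have := h.queue j hj1 (by omega)
      rw [Function.update_of_ne hj]
      simp only [Function.update_apply]
      grind
  · intro e he hm hs
    have h4 := h3 e he hm hs
    have h5 := h.scanned e he hm
    simp only [Function.update_apply]
    grind
  · exact fun u h1 h2 h3 => pending_push _ (pending_update hq _ (h.free u h1 h2 h3))
  · intro x hx hox
    by_cases hxe : x = c (cur (Q qh))
    · subst hxe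
      exact .inr ⟨qt, by omega, by omega, by rw [Function.update_self]⟩
    · rw [Function.update_of_ne hxe] at hx
      exact pending_push _ (pending_update hq _ (h.visited x hx hox))
  · intro x
    have := h.vis_le x
    simp only [Function.update_apply]
    grind
  · exact h.parentOK_visit hq h0 hv
  · intro x hx hox
    rw [Function.update_of_ne (by rintro rfl; exact ho hox)] at hx
    exact h.found x hx hox
  · simp
  · simp

/-- An unsuccessful search proves the matching to be maximum. -/
theorem card_le (hL : Lists m l head nxt)
    (h : Search m T0 l c owner mate cur vis par Q T qh qt 0) (hq : ¬ qh < qt)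
    {S : Finset ℕ} (hS : S ⊆ Finset.Icc 1 m) (hl : Set.InjOn l (S : Set ℕ))
    (hc : Set.InjOn c (S : Set ℕ)) : S.card ≤ (matched m c owner).card := by
  have key : ∀ u, Pending cur Q qh qt u → cur u = 0 := by
    rintro u (h | ⟨j, h1, h2, -⟩)
    · exact h
    · omega
  -- Kőnig's cover: the left vertices not fully scanned together with the visited colors. No visited
  -- color is free, and a matched edge is covered only once, because the owner of a visited color
  -- has been scanned.
  have := h.isMate.card_mul_le (fun u => if cur u = 0 then 0 else 1)
    (fun x => if T0 < vis x then 1 else 0) 1 1 ?_ ?_ ?_ ?_ hS hl hc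
  · simpa using this
  · intro e h1 h2
    have := h.scanned e h1 h2
    grind
  · intro e h1 h2 h3
    have h4 := h.visited (c e)
    rw [h3] at h4
    have h5 := key (l e)
    grind
  · intro e h1 h2 h3
    have h4 := hL.left_mem e h1 h2
    have := key _ (h.free (l e) h4.1 h4.2 h3)
    simp [this]
  · intro e h1 h2 h3
    have := h.found (c e)
    grind

end Search

/-! ### Augmentation -/

/-- Invariant of the augmentation: the color `fnd - 1` is to be matched with its parent; its
entry in `owner` is meaningless. The matching that is being augmented has `N` edges. -/
structure Augment (m T0 N : ℕ) (l c owner mate vis par : ℕ → ℕ) (T fnd : ℕ) : Prop where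
  vis_le : ∀ x, vis x ≤ T
  le : T ≤ T0 + m
  active : fnd ≠ 0 → IsMate m l c (Function.update owner (fnd - 1) 0) mate ∧
    (matched m c (Function.update owner (fnd - 1) 0)).card = N ∧ T0 < vis (fnd - 1) ∧
    ∀ x, T0 < vis x → vis x ≤ vis (fnd - 1) → ParentOK m T0 l c mate vis par x
  finished : fnd = 0 → IsMate m l c owner mate ∧ (matched m c owner).card = N + 1

namespace Augment

variable {m T0 N : ℕ} {l c owner mate cur vis par Q : ℕ → ℕ} {T qh qt fnd : ℕ}

/-- The color found is free, so at the start erasing its entry in `owner` changes nothing. -/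
theorem of_search (h : Search m T0 l c owner mate cur vis par Q T qh qt fnd) (h0 : fnd ≠ 0) :
    Augment m T0 (matched m c owner).card l c owner mate vis par T fnd := by
  have hb := h.budget
  refine ⟨h.vis_le, by omega, fun _ => ?_, fun h1 => absurd h1 h0⟩
  have : Function.update owner (fnd - 1) 0 = owner := by
    rw [← h.found_free h0, Function.update_eq_self]
  rw [this]
  exact ⟨h.isMate, rfl, h.found_vis h0, fun x hx _ => h.parent x hx⟩

theorem last (h : Augment m T0 N l c owner mate vis par T fnd) (h0 : fnd ≠ 0)
    (hm : mate (l (par (fnd - 1))) = 0) :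
    Augment m T0 N l c (Function.update owner (fnd - 1) (par (fnd - 1)))
      (Function.update mate (l (par (fnd - 1))) (par (fnd - 1))) vis par T 0 := by
  obtain ⟨h1, h2, h3, h4⟩ := h.active h0
  obtain ⟨p1, p2, p3, -⟩ := h4 _ h3 le_rfl
  obtain ⟨h5, h6⟩ := h1.take p1 p2 hm (by rw [p3, Function.update_self])
  rw [p3, Function.update_idem] at h5 h6
  exact ⟨h.vis_le, h.le, fun h => absurd rfl h, fun _ => ⟨h5, by rw [h6, h2]⟩⟩

/-- The left end of the parent edge takes the color `fnd - 1` and releases its former color, which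
must be matched next. That color was visited earlier, so the stamps decrease along the path and the
walk ends. -/
theorem step (h : Augment m T0 N l c owner mate vis par T fnd) (h0 : fnd ≠ 0)
    (hm : mate (l (par (fnd - 1))) ≠ 0) :
    Augment m T0 N l c (Function.update owner (fnd - 1) (par (fnd - 1)))
      (Function.update mate (l (par (fnd - 1))) (par (fnd - 1))) vis par T
      (c (mate (l (par (fnd - 1)))) + 1) ∧
    vis (c (mate (l (par (fnd - 1))))) - T0 < vis (fnd - 1) - T0 := by
  obtain ⟨h1, h2, h3, h4⟩ := h.active h0
  set x := fnd - 1
  set e := par x with he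
  set o := mate (l e) with ho
  obtain ⟨p1, p2, p3, p4⟩ := h4 x h3 le_rfl
  rw [← he] at p1 p2 p3 p4
  obtain ⟨p5, p6⟩ := p4.resolve_left hm
  rw [← ho] at p5 p6
  obtain ⟨q1, q2, q3⟩ := h1.mate_spec _ hm
  rw [← ho] at q1 q2 q3
  have hx : c o ≠ x := fun h => by rw [h, Function.update_self] at q3; exact hm q3.symm
  -- With the sides exchanged, the free color `x` takes the left vertex `l e` away from the color `c
  -- o`.
  obtain ⟨h5, h6⟩ := h1.symm.steal p1 p2 (by rw [p3, Function.update_self]) hm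
  rw [p3, Function.update_comm hx, Function.update_idem, Function.update_comm hx.symm] at h5
  have hfun : Function.update (Function.update owner (c o) 0) x e
      = Function.update (Function.update owner x e) (c o) 0 := Function.update_comm hx _ _ _
  refine ⟨⟨h.vis_le, h.le, fun _ => ?_, by simp⟩, by omega⟩
  rw [Nat.add_sub_cancel]
  have h7 := h5.symm
  refine ⟨by simpa [hfun] using h7, ?_, p5, ?_⟩
  · rw [← h2, ← h1.matched_symm, ← h6]
    rw [← IsMate.matched_symm (by simpa [hfun] using h7)]
  · intro y hy1 hy2
    obtain ⟨r1, r2, r3, r4⟩ := h4 y hy1 (by omega)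
    -- If `l e` were met again, `ParentOK` would give `vis (c o) < vis y`, against `hy2`. Hence the
    -- rest of the path does not see the change of `mate`.
    have hne : l (par y) ≠ l e := fun hne => by
      rw [hne] at r4
      rcases r4 with r4 | r4
      · exact hm r4
      · rw [← ho] at r4
        omega
    unfold ParentOK
    rw [Function.update_of_ne hne]
    exact ⟨r1, r2, r3, r4⟩

end Augment

/-! ### The main loops

Registers: `1` number of edges, `2` loop counter, `3` left vertex, `4` integer square root of the
number of edges, `5` and `6` auxiliary values for its computation, `8` active left vertex, `9` current edge, `10` displaced edge, `11` and `12` time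
stamps, `13` and `14` ends of the queue, `15` color found (plus one), `16` whether to continue.
Arrays: `0`, `1` and `2` input, `3` output, `4` and `5` left vertices and colors of the edges `1, …, m`,
`6` left vertices of the edges at a vertex, `7` and `8` adjacency lists,
`9` counters, `10` prices, `11` and `12` matching edges at colors and left vertices, `13` cursors,
`14` visiting times, `15` parents, `16` queue. -/

namespace Store

variable (s : Store) (a b i v x y : ℕ)

@[simp]
theorem setReg_reg_self : (s.setReg x v).reg x = v := by simp [setReg]

@[simp]
theorem setReg_reg_of_ne (h : y ≠ x) : (s.setReg x v).reg y = s.reg y := by simp [setReg, h]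

@[simp]
theorem setReg_arr : (s.setReg x v).arr = s.arr := rfl

@[simp]
theorem setArr_reg : (s.setArr a i v).reg = s.reg := rfl

@[simp]
theorem setArr_arr_self : (s.setArr a i v).arr a = Function.update (s.arr a) i v := by
  simp [setArr]

@[simp]
theorem setArr_arr_of_ne (h : b ≠ a) : (s.setArr a i v).arr b = s.arr b := by simp [setArr, h]

end Store

attribute [simp] block Program.exec Expr.eval

namespace Test

variable (s : Store) (e f : Expr) (b c : Test)

@[simp]
theorem eval_eq_true : (eq e f).eval s = true ↔ e.eval s = f.eval s := by simp [Test.eval]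

@[simp]
theorem eval_eq_false : (eq e f).eval s = false ↔ e.eval s ≠ f.eval s := by simp [Test.eval]

@[simp]
theorem eval_lt_true : (lt e f).eval s = true ↔ e.eval s < f.eval s := by simp [Test.eval]

@[simp]
theorem eval_lt_false : (lt e f).eval s = false ↔ f.eval s ≤ e.eval s := by simp [Test.eval]

@[simp]
theorem eval_neg_true : (neg b).eval s = true ↔ b.eval s = false := by simp [Test.eval]

@[simp]
theorem eval_neg_false : (neg b).eval s = false ↔ b.eval s = true := by simp [Test.eval]

@[simp]
theorem eval_conj_true : (conj b c).eval s = true ↔ b.eval s = true ∧ c.eval s = true := by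
  simp [Test.eval]

@[simp]
theorem eval_conj_false : (conj b c).eval s = false ↔ (b.eval s = true → c.eval s = false) := by
  simp [Test.eval]

@[simp]
theorem eval_disj_true : (disj b c).eval s = true ↔ b.eval s = true ∨ c.eval s = true := by
  simp [Test.eval]

@[simp]
theorem eval_disj_false : (disj b c).eval s = false ↔ b.eval s = false ∧ c.eval s = false := by
  simp [Test.eval]

end Test

/-! ### The auction loop -/

/-- The part of the memory that does not change after the preparation. -/
structure Frame (m : ℕ) (l c head nxt : ℕ → ℕ) (s : Store) : Prop where
  reg1 : s.reg 1 = m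
  arr3 : s.arr 3 = fun _ => 0
  arr4 : s.arr 4 = l
  arr5 : s.arr 5 = c
  arr7 : s.arr 7 = head
  arr8 : s.arr 8 = nxt

open RainbowMatching.Expr RainbowMatching.Test RainbowMatching.Program in
/-- One step of the auction. -/
def auctionBody : Program :=
  cond (eq (reg 8) (const 0))
    (block [assign 2 (succ (reg 2)),
      cond (eq (get 7 (reg 2)) (const 0)) skip (assign 8 (reg 2))])
    (cond (lt (get 9 (get 13 (reg 8))) (succ (reg 4)))
      (block [assign 9 (get 13 (reg 8)),
        write 9 (reg 9) (succ (get 9 (reg 9))),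
        cond (eq (get 8 (reg 9)) (const 0)) (write 13 (reg 8) (get 7 (reg 8)))
          (write 13 (reg 8) (get 8 (reg 9))),
        cond (lt (get 10 (get 5 (reg 9))) (get 9 (reg 9)))
          (block [assign 10 (get 11 (get 5 (reg 9))),
            write 11 (get 5 (reg 9)) (reg 9),
            write 10 (get 5 (reg 9)) (get 9 (reg 9)),
            cond (eq (reg 10) (const 0))
              (block [write 12 (reg 8) (reg 9), assign 8 (const 0)])
              (block [write 12 (get 4 (reg 10)) (const 0), write 12 (reg 8) (reg 9),
                assign 8 (get 4 (reg 10))])])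
          skip])
      (assign 8 (const 0)))

open RainbowMatching.Expr RainbowMatching.Test in
/-- Test of the auction loop. -/
def auctionTest : Test := disj (lt (reg 2) (reg 1)) (neg (eq (reg 8) (const 0)))

/-- Invariant of the auction loop. -/
structure AuctionState (m k : ℕ) (l c head nxt : ℕ → ℕ) (s : Store) : Prop where
  frame : Frame m l c head nxt s
  reg4 : s.reg 4 + 1 = k
  auction : Auction m k l c head (s.arr 9) (s.arr 10) (s.arr 11) (s.arr 12) (s.arr 13) (s.reg 2)
    (s.reg 8) 0
  reg11 : s.reg 11 = 0
  arr14 : s.arr 14 = fun _ => 0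

/-- Potential of the auction. -/
def auctionPotential (m k : ℕ) (s : Store) : ℕ :=
  2 * ∑ e ∈ Finset.Icc 1 m, (k - s.arr 9 e) + 2 * (m - s.reg 2) + if s.reg 8 = 0 then 0 else 1

theorem sum_sub_update {m k e : ℕ} {cnt : ℕ → ℕ} (he : 1 ≤ e) (hm : e ≤ m) (hk : cnt e < k) :
    ∑ f ∈ Finset.Icc 1 m, (k - Function.update cnt e (cnt e + 1) f) + 1 =
      ∑ f ∈ Finset.Icc 1 m, (k - cnt f) := by
  have hmem : e ∈ Finset.Icc 1 m := Finset.mem_Icc.2 ⟨he, hm⟩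
  rw [← Finset.add_sum_erase _ _ hmem, ← Finset.add_sum_erase _ (fun f => k - cnt f) hmem,
    Function.update_self]
  have : ∑ f ∈ (Finset.Icc 1 m).erase e, (k - Function.update cnt e (cnt e + 1) f) =
      ∑ f ∈ (Finset.Icc 1 m).erase e, (k - cnt f) :=
    Finset.sum_congr rfl fun f hf => by rw [Function.update_of_ne (Finset.ne_of_mem_erase hf)]
  rw [this]
  omega

/-- Every examination lowers the sum of the remaining examinations by one. Starting a left vertex
may make `reg 8` nonzero, which raises the potential by one; the factor 2 at `m - s.reg 2` pays for
it. -/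
theorem auctionBody_spec {m k : ℕ} {l c head nxt : ℕ → ℕ} (hL : Lists m l head nxt) (s : Store)
    (h : AuctionState m k l c head nxt s) (hb : auctionTest.eval s = true) :
    AuctionState m k l c head nxt (auctionBody.exec s) ∧
      auctionPotential m k (auctionBody.exec s) < auctionPotential m k s := by
  obtain ⟨⟨f1, f3, f4, f5, f7, f8⟩, h4, hA, h11, h14⟩ := h
  simp [auctionTest, f1] at hb
  by_cases h8 : s.reg 8 = 0
  · have hi : s.reg 2 < m := by simpa [h8] using hb
    rw [h8] at hA
    by_cases h0 : head (s.reg 2 + 1) = 0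
    · simp [auctionBody, h8, f7, h0]
      refine ⟨⟨⟨?_, ?_, ?_, ?_, ?_, ?_⟩, ?_, ?_, ?_, ?_⟩, ?_⟩
      all_goals simp [*, auctionPotential]
      · exact hA.pass hi h0
      · omega
    · simp [auctionBody, h8, f7, h0]
      refine ⟨⟨⟨?_, ?_, ?_, ?_, ?_, ?_⟩, ?_, ?_, ?_, ?_⟩, ?_⟩
      all_goals simp [*, auctionPotential]
      · exact hA.activate hi h0
      · omega
  by_cases hk : s.arr 9 (s.arr 13 (s.reg 8)) < k
  swap
  · simp [auctionBody, h8, h4, hk]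
    refine ⟨⟨⟨?_, ?_, ?_, ?_, ?_, ?_⟩, ?_, ?_, ?_, ?_⟩, ?_⟩
    all_goals simp [*, auctionPotential]
    · exact hA.drop (by omega)
  obtain ⟨e1, e2, e3⟩ := hA.cur_pos h8
  have hsum := sum_sub_update e1 e2 hk
  have hN := hA.advance hL h8 hk rfl
  generalize he : s.arr 13 (s.reg 8) = e at *
  by_cases hp : s.arr 10 (c e) < s.arr 9 e + 1
  · by_cases ho : s.arr 11 (c e) = 0
    · have hT := hN.take h8 e1 e2 e3 (by simp; omega) ho
      by_cases hn : nxt e = 0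
      all_goals
        simp [auctionBody, h8, h4, hk, he, f5, f8, f7, hn, hp, ho]
        refine ⟨⟨⟨?_, ?_, ?_, ?_, ?_, ?_⟩, ?_, ?_, ?_, ?_⟩, ?_⟩
        all_goals simp [auctionPotential, f1, f3, f4, f5, f7, f8, h4, h11, h14, h8]
        · simpa [hn] using hT
        · omega
    · have hT := hN.steal hL h8 e1 e2 e3 (by simp; omega) ho
      by_cases hn : nxt e = 0
      all_goals
        simp [auctionBody, h8, h4, hk, he, f4, f5, f8, f7, hn, hp, ho]
        refine ⟨⟨⟨?_, ?_, ?_, ?_, ?_, ?_⟩, ?_, ?_, ?_, ?_⟩, ?_⟩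
        all_goals simp [auctionPotential, f1, f3, f4, f5, f7, f8, h4, h11, h14, h8]
        · simpa [hn] using hT
        · grind
  · have hT := hN.settle (by simp; omega)
    by_cases hn : nxt e = 0
    all_goals
      simp [auctionBody, h8, h4, hk, he, f5, f8, f7, hn, hp]
      refine ⟨⟨⟨?_, ?_, ?_, ?_, ?_, ?_⟩, ?_, ?_, ?_, ?_⟩, ?_⟩
      all_goals simp [auctionPotential, f1, f3, f4, f5, f7, f8, h4, h11, h14, h8]
      · simpa [hn] using hT
      · omega

/-- State between two augmentations: `N` edges are matched. -/
structure PhaseState (m N : ℕ) (l c head nxt : ℕ → ℕ) (s : Store) : Prop where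
  frame : Frame m l c head nxt s
  isMate : IsMate m l c (s.arr 11) (s.arr 12)
  card : (matched m c (s.arr 11)).card = N
  vis_le : ∀ x, s.arr 14 x ≤ s.reg 11
  cur_le : ∀ u, s.arr 13 u ≤ m
  cur_left : ∀ u, s.arr 13 u ≠ 0 → l (s.arr 13 u) = u
  reg16 : s.reg 16 = 1

/-! ### Initialization of a search -/

open RainbowMatching.Expr RainbowMatching.Program in
/-- Reset the registers used by a search. -/
def searchReset : Program :=
  block [assign 2 (const 0), assign 12 (reg 11), assign 13 (const 0), assign 14 (const 0),
    assign 15 (const 0)]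

open RainbowMatching.Expr RainbowMatching.Test RainbowMatching.Program in
/-- Reset the cursor of one left vertex, which is put into the queue if it is free. -/
def searchInitBody : Program :=
  block [assign 2 (succ (reg 2)), write 13 (reg 2) (get 7 (reg 2)),
    cond (eq (get 12 (reg 2)) (const 0))
      (block [write 16 (reg 14) (reg 2), assign 14 (succ (reg 14))]) skip]

open RainbowMatching.Expr RainbowMatching.Test in
/-- Test of the loops over the edges or the left vertices. -/
def countTest : Test := lt (reg 2) (reg 1)

/-- Invariant of the initialization of a search. -/
structure SearchInitState (m N : ℕ) (l c head nxt : ℕ → ℕ) (s : Store) : Prop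
    extends PhaseState m N l c head nxt s where
  reg12 : s.reg 12 = s.reg 11
  reg13 : s.reg 13 = 0
  reg15 : s.reg 15 = 0
  reg14_le : s.reg 14 ≤ s.reg 2
  reg2_le : s.reg 2 ≤ m
  cur_head : ∀ u, 1 ≤ u → u ≤ s.reg 2 → s.arr 13 u = head u
  free : ∀ u, 1 ≤ u → u ≤ s.reg 2 → s.arr 12 u = 0 → ∃ j, j < s.reg 14 ∧ s.arr 16 j = u
  queue : ∀ j, j < s.reg 14 → s.arr 12 (s.arr 16 j) = 0

variable {m N : ℕ} {l c head nxt : ℕ → ℕ}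

/-- Setting the threshold in register `12` to the current time makes all old visiting marks
obsolete, so array `14` need not be cleared, although colors may be arbitrarily large. -/
theorem searchReset_spec (s : Store) (h : PhaseState m N l c head nxt s) :
    SearchInitState m N l c head nxt (searchReset.exec s) := by
  obtain ⟨⟨f1, f3, f4, f5, f7, f8⟩, hM, hN, hv, hc, hl, h16⟩ := h
  simp only [searchReset, block, Program.exec, Expr.eval]
  refine ⟨⟨⟨?_, ?_, ?_, ?_, ?_, ?_⟩, ?_, ?_, ?_, ?_, ?_, ?_⟩, ?_, ?_, ?_, ?_, ?_, ?_, ?_, ?_⟩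
  all_goals simp +contextual [*]
  all_goals omega

theorem searchInitBody_spec (hL : Lists m l head nxt) (s : Store)
    (h : SearchInitState m N l c head nxt s) (hb : countTest.eval s = true) :
    SearchInitState m N l c head nxt (searchInitBody.exec s) ∧
      m - (searchInitBody.exec s).reg 2 < m - s.reg 2 := by
  obtain ⟨⟨⟨f1, f3, f4, f5, f7, f8⟩, hM, hN, hv, hc, hl, h16⟩, h12, h13, h15, h14, h2, hch, hf,
    hq⟩ := h
  have hi : s.reg 2 < m := by simpa [countTest, f1] using hb
  have hc' : ∀ u, Function.update (s.arr 13) (s.reg 2 + 1) (head (s.reg 2 + 1)) u ≤ m := fun u => by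
    have h1 := hc u
    have h2 := hL.head_le u
    simp only [Function.update_apply]
    grind
  have hl' : ∀ u, Function.update (s.arr 13) (s.reg 2 + 1) (head (s.reg 2 + 1)) u ≠ 0 →
      l (Function.update (s.arr 13) (s.reg 2 + 1) (head (s.reg 2 + 1)) u) = u := fun u => by
    have h1 := hl u
    have h2 := hL.head_left u
    simp only [Function.update_apply]
    grind
  have hch' : ∀ u, 1 ≤ u → u ≤ s.reg 2 + 1 →
      Function.update (s.arr 13) (s.reg 2 + 1) (head (s.reg 2 + 1)) u = head u := fun u h1 h2 => by
    have h3 := hch u h1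
    simp only [Function.update_apply]
    grind
  by_cases h0 : s.arr 12 (s.reg 2 + 1) = 0
  · simp [searchInitBody, f7, h0]
    refine ⟨⟨⟨⟨?_, ?_, ?_, ?_, ?_, ?_⟩, ?_, ?_, ?_, by simpa using hc', by simpa using hl', ?_⟩,
      ?_, ?_, ?_, ?_, ?_, by simpa using hch', ?_, ?_⟩, ?_⟩
    all_goals try simp [*]
    · intro u h1 h2 h3
      by_cases hu : u = s.reg 2 + 1
      · exact ⟨s.reg 14, by omega, by simp [hu]⟩
      · obtain ⟨j, h4, h5⟩ := hf u h1 (by omega) h3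
        exact ⟨j, by omega, by rwa [Function.update_of_ne (by omega)]⟩
    · intro j h1
      by_cases hj : j = s.reg 14
      · simp [hj, h0]
      · rw [Function.update_of_ne hj]
        exact hq j (by omega)
    · omega
  · simp [searchInitBody, f7, h0]
    refine ⟨⟨⟨⟨?_, ?_, ?_, ?_, ?_, ?_⟩, ?_, ?_, ?_, by simpa using hc', by simpa using hl', ?_⟩,
      ?_, ?_, ?_, ?_, ?_, by simpa using hch', ?_, ?_⟩, ?_⟩
    all_goals try simp [*]
    · omega
    · intro u h1 h2 h3
      exact hf u h1 (by by_contra h4; exact h0 (by rwa [show s.reg 2 + 1 = u by omega])) h3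
    all_goals omega

/-! ### Search -/

open RainbowMatching.Expr RainbowMatching.Test RainbowMatching.Program in
/-- One step of the search. -/
def searchBody : Program :=
  cond (eq (get 13 (get 16 (reg 13))) (const 0)) (assign 13 (succ (reg 13)))
    (block [assign 9 (get 13 (get 16 (reg 13))),
      write 13 (get 16 (reg 13)) (get 8 (reg 9)),
      cond (lt (reg 12) (get 14 (get 5 (reg 9)))) skip
        (block [assign 11 (succ (reg 11)), write 14 (get 5 (reg 9)) (reg 11),
          write 15 (get 5 (reg 9)) (reg 9),
          cond (eq (get 11 (get 5 (reg 9))) (const 0)) (assign 15 (succ (get 5 (reg 9))))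
            (block [write 16 (reg 14) (get 4 (get 11 (get 5 (reg 9)))),
              assign 14 (succ (reg 14))])])])

open RainbowMatching.Expr RainbowMatching.Test in
/-- Test of the search loop. -/
def searchTest : Test := conj (lt (reg 13) (reg 14)) (eq (reg 15) (const 0))

/-- Invariant of the search loop. -/
structure SearchState (m N : ℕ) (l c head nxt : ℕ → ℕ) (s : Store) : Prop where
  frame : Frame m l c head nxt s
  search : Search m (s.reg 12) l c (s.arr 11) (s.arr 12) (s.arr 13) (s.arr 14) (s.arr 15)
    (s.arr 16) (s.reg 11) (s.reg 13) (s.reg 14) (s.reg 15)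
  card : (matched m c (s.arr 11)).card = N
  reg16 : s.reg 16 = 1

/-- Potential of the search. -/
def searchPotential (m : ℕ) (l : ℕ → ℕ) (s : Store) : ℕ :=
  2 * unscanned m l (s.arr 13) + (s.reg 14 - s.reg 13)

/-- No color has a stamp above the threshold yet, and all cursors are at the heads. The bound `3 *
m` consists of twice the `m` unscanned edges and a queue of at most `m` left vertices. -/
theorem SearchInitState.searchState (hL : Lists m l head nxt) {s : Store}
    (h : SearchInitState m N l c head nxt s) (hb : countTest.eval s = false) :
    SearchState m N l c head nxt s ∧ searchPotential m l s ≤ 3 * m := by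
  have hf := h.frame
  have hi : s.reg 2 = m := by
    have h1 : m ≤ s.reg 2 := by simpa [countTest, hf.reg1] using hb
    have := h.reg2_le
    omega
  have hU := unscanned_le m l (s.arr 13)
  have h12 := h.reg12
  refine ⟨⟨hf, ⟨h.isMate, h.cur_le, h.cur_left, ?_, ?_, ?_, ?_, h.vis_le, ?_, ?_, ?_, ?_, ?_, ?_⟩,
    h.card, h.reg16⟩, ?_⟩
  · exact fun j _ h2 => .inl (h.queue j h2)
  · intro e h1 h2 h3
    have h4 := hL.left_mem e h1 h2
    have h5 := hL.le_head e h1 h2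
    rw [h.cur_head _ h4.1 (by omega)] at h3
    omega
  · intro u h1 h2 h3
    obtain ⟨j, h4, h5⟩ := h.free u h1 (by omega) h3
    exact .inr ⟨j, by rw [h.reg13]; omega, h4, h5⟩
  · intro x h1
    have := h.vis_le x
    omega
  · intro x h1
    have := h.vis_le x
    omega
  · intro x h1
    have := h.vis_le x
    omega
  · exact fun h1 => absurd h.reg15 h1
  · exact fun h1 => absurd h.reg15 h1
  · omega
  · omega
  · have := h.reg14_le
    unfold searchPotential
    omega

/-- A scanned edge may lengthen the queue by one; this is why unscanned edges have weight 2. -/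
theorem searchBody_spec (hL : Lists m l head nxt) (s : Store)
    (h : SearchState m N l c head nxt s) (hb : searchTest.eval s = true) :
    SearchState m N l c head nxt (searchBody.exec s) ∧
      searchPotential m l (searchBody.exec s) < searchPotential m l s := by
  obtain ⟨⟨f1, f3, f4, f5, f7, f8⟩, hS, hN, h16⟩ := h
  simp [searchTest] at hb
  obtain ⟨hq, h15⟩ := hb
  rw [h15] at hS
  by_cases h0 : s.arr 13 (s.arr 16 (s.reg 13)) = 0
  · simp [searchBody, h0]
    refine ⟨⟨⟨?_, ?_, ?_, ?_, ?_, ?_⟩, ?_, ?_, ?_⟩, ?_⟩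
    all_goals simp [*, searchPotential]
    · exact hS.pop h0
    · omega
  have hU := unscanned_update hL h0 (hS.cur_le _) (hS.cur_left _ h0)
  by_cases hv : s.reg 12 < s.arr 14 (c (s.arr 13 (s.arr 16 (s.reg 13))))
  · simp [searchBody, h0, f8, f5, hv]
    refine ⟨⟨⟨?_, ?_, ?_, ?_, ?_, ?_⟩, ?_, ?_, ?_⟩, ?_⟩
    all_goals simp [searchPotential, f1, f3, f4, f5, f7, f8, hN, h16, h15]
    · exact hS.skip hL hq h0 hv
    · omega
  by_cases ho : s.arr 11 (c (s.arr 13 (s.arr 16 (s.reg 13)))) = 0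
  · simp [searchBody, h0, f8, f5, hv, ho]
    refine ⟨⟨⟨?_, ?_, ?_, ?_, ?_, ?_⟩, ?_, ?_, ?_⟩, ?_⟩
    all_goals simp [searchPotential, f1, f3, f4, f5, f7, f8, hN, h16]
    · exact hS.visit_free hL hq h0 (by omega) ho
    · omega
  · simp [searchBody, h0, f8, f5, f4, hv, ho]
    refine ⟨⟨⟨?_, ?_, ?_, ?_, ?_, ?_⟩, ?_, ?_, ?_⟩, ?_⟩
    all_goals simp [searchPotential, f1, f3, f4, f5, f7, f8, hN, h16, h15]
    · exact hS.visit_owned hL hq h0 (by omega) ho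
    · omega

/-! ### Augmentation -/

open RainbowMatching.Expr RainbowMatching.Test RainbowMatching.Program in
/-- One step of an augmentation. -/
def augmentBody : Program :=
  block [assign 9 (get 15 (pred (reg 15))), assign 10 (get 12 (get 4 (reg 9))),
    write 11 (pred (reg 15)) (reg 9), write 12 (get 4 (reg 9)) (reg 9),
    cond (eq (reg 10) (const 0)) (assign 15 (const 0)) (assign 15 (succ (get 5 (reg 10))))]

open RainbowMatching.Expr RainbowMatching.Test in
/-- Test of the augmentation loop. -/
def augmentTest : Test := lt (const 0) (reg 15)

/-- Invariant of the augmentation loop. -/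
structure AugmentState (m N : ℕ) (l c head nxt : ℕ → ℕ) (s : Store) : Prop where
  frame : Frame m l c head nxt s
  augment : Augment m (s.reg 12) N l c (s.arr 11) (s.arr 12) (s.arr 14) (s.arr 15) (s.reg 11)
    (s.reg 15)
  cur_le : ∀ u, s.arr 13 u ≤ m
  cur_left : ∀ u, s.arr 13 u ≠ 0 → l (s.arr 13 u) = u
  reg16 : s.reg 16 = 1

/-- Potential of an augmentation. -/
def augmentPotential (s : Store) : ℕ :=
  if s.reg 15 = 0 then 0 else s.arr 14 (s.reg 15 - 1) - s.reg 12

/-- Each visit spends a scanned edge, so by `budget` the stamps exceed the threshold by at most `m`,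
which bounds the length of the path. -/
theorem SearchState.augmentState {s : Store} (h : SearchState m N l c head nxt s)
    (h0 : s.reg 15 ≠ 0) :
    AugmentState m N l c head nxt s ∧ augmentPotential s ≤ m := by
  have hA := Augment.of_search h.search h0
  rw [h.card] at hA
  refine ⟨⟨h.frame, hA, h.search.cur_le, h.search.cur_left, h.reg16⟩, ?_⟩
  have h1 := hA.vis_le (s.reg 15 - 1)
  have h2 := hA.le
  simp only [augmentPotential, h0, if_false]
  omega

theorem AugmentState.phaseState {s : Store} (h : AugmentState m N l c head nxt s)
    (hb : augmentTest.eval s = false) : PhaseState m (N + 1) l c head nxt s := by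
  have h0 : s.reg 15 = 0 := by simpa [augmentTest] using hb
  obtain ⟨h1, h2⟩ := h.augment.finished h0
  exact ⟨h.frame, h1, h2, h.augment.vis_le, h.cur_le, h.cur_left, h.reg16⟩

theorem augmentBody_spec (s : Store)
    (h : AugmentState m N l c head nxt s) (hb : augmentTest.eval s = true) :
    AugmentState m N l c head nxt (augmentBody.exec s) ∧
      augmentPotential (augmentBody.exec s) < augmentPotential s := by
  obtain ⟨⟨f1, f3, f4, f5, f7, f8⟩, hA, hc, hl, h16⟩ := h
  have h0 : s.reg 15 ≠ 0 := by
    simp [augmentTest] at hb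
    omega
  have hpos := (hA.active h0).2.2.1
  by_cases hm : s.arr 12 (l (s.arr 15 (s.reg 15 - 1))) = 0
  · simp [augmentBody, f4, hm]
    refine ⟨⟨⟨?_, ?_, ?_, ?_, ?_, ?_⟩, ?_, ?_, ?_, ?_⟩, ?_⟩
    all_goals simp [augmentPotential, f1, f3, f4, f5, f7, f8, h16, h0]
    · exact hA.last h0 hm
    · exact hc
    · exact hl
    · omega
  · obtain ⟨h1, h2⟩ := hA.step h0 hm
    simp [augmentBody, f4, f5, hm]
    refine ⟨⟨⟨?_, ?_, ?_, ?_, ?_, ?_⟩, ?_, ?_, ?_, ?_⟩, ?_⟩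
    all_goals simp [augmentPotential, f1, f3, f4, f5, f7, f8, h16, h0]
    · exact h1
    · exact hc
    · exact hl
    · omega

/-! ### A phase -/

/-- A maximum matching has been found. -/
structure Optimal (m : ℕ) (l c head nxt : ℕ → ℕ) (s : Store) : Prop where
  frame : Frame m l c head nxt s
  isMate : IsMate m l c (s.arr 11) (s.arr 12)
  card_le : ∀ S : Finset ℕ, S ⊆ Finset.Icc 1 m → Set.InjOn l (S : Set ℕ) →
    Set.InjOn c (S : Set ℕ) → S.card ≤ (matched m c (s.arr 11)).card

open RainbowMatching.Expr RainbowMatching.Test RainbowMatching.Program in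
/-- Search for an augmenting path and augment, or stop if there is none. -/
def phase : Program :=
  seq searchReset (seq (loop countTest searchInitBody) (seq (loop searchTest searchBody)
    (cond (eq (reg 15) (const 0)) (assign 16 (const 0)) (loop augmentTest augmentBody))))

theorem phase_spec (hL : Lists m l head nxt) (N : ℕ) :
    Computes phase (PhaseState m N l c head nxt)
      (fun s => PhaseState m (N + 1) l c head nxt s ∨
        (s.reg 16 = 0 ∧ Optimal m l c head nxt s)) (400 * (m + 1)) := by
  have h1 : Computes searchReset (PhaseState m N l c head nxt)
      (fun s => SearchInitState m N l c head nxt s ∧ m - s.reg 2 ≤ m) _ :=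
    Computes.exec rfl fun s hs => ⟨searchReset_spec s hs, Nat.sub_le _ _⟩
  have h2 := Computes.loop_exec (I := SearchInitState m N l c head nxt) (fun s => m - s.reg 2)
    (N := m) rfl (searchInitBody_spec (c := c) hL)
  have h3 := Computes.loop_exec (N := 3 * m) (searchPotential m l) rfl
    (searchBody_spec (c := c) (N := N) hL)
  have h4 := Computes.loop_exec (N := m) augmentPotential rfl
    (augmentBody_spec (m := m) (l := l) (c := c) (head := head) (nxt := nxt) (N := N))
  have h5 : Computes (.assign 16 (.const 0))
      (fun s => (SearchState m N l c head nxt s ∧ searchTest.eval s = false) ∧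
        (Test.eq (.reg 15) (.const 0)).eval s = true)
      (fun s => PhaseState m (N + 1) l c head nxt s ∨
        (s.reg 16 = 0 ∧ Optimal m l c head nxt s)) 2 := by
    refine Computes.exec rfl fun s hs => ?_
    right
    obtain ⟨⟨hS, hb⟩, h0⟩ := hs
    have h0 : s.reg 15 = 0 := by simpa using h0
    have hb : ¬ s.reg 13 < s.reg 14 := by simpa [searchTest, h0] using hb
    have hS' := hS.search
    rw [h0] at hS'
    obtain ⟨f1, f3, f4, f5, f7, f8⟩ := hS.frame
    refine ⟨by simp, ⟨by simpa, by simpa, by simpa, by simpa, by simpa, by simpa⟩, ?_, ?_⟩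
    · simpa using hS'.isMate
    · intro S
      simpa using hS'.card_le hL hb
  have h6 := Computes.cond (T := (augmentBody.maxCost + augmentTest.cost) * m + augmentTest.cost + 2)
    (h5.mono (fun _ h => h) (fun _ h => h) (by omega))
    (h4.mono (P' := fun s => (SearchState m N l c head nxt s ∧ searchTest.eval s = false) ∧
        (Test.eq (.reg 15) (.const 0)).eval s = false)
      (fun s hs => hs.1.1.augmentState (by simpa using hs.2))
      (fun s hs => .inl (hs.1.phaseState hs.2)) (by omega))
  have h7 := h3.mono (fun s hs => hs) (fun _ h => h) le_rfl |>.seq h6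
  have h8 := h2.mono (fun _ h => h) (fun s hs => hs.1.searchState hL hs.2) le_rfl |>.seq h7
  refine (h1.seq h8).mono (fun _ h => h) (fun _ h => h) ?_
  -- Evaluates the constant costs of the bodies; `400` is a generous bound for the resulting linear
  -- function of `m`.
  simp [searchReset, searchInitBody, searchBody, augmentBody, countTest, searchTest, augmentTest,
    block, Program.maxCost, Expr.cost, Test.cost]
  omega

/-! ### Preparation -/

/-- Two edges have a common endvertex. -/
def Meet (X Y : ℕ → ℕ) (r r' : ℕ) : Prop :=
  X r = X r' ∨ X r = Y r' ∨ Y r = X r' ∨ Y r = Y r'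

theorem Meet.symm {X Y : ℕ → ℕ} {r r' : ℕ} (h : Meet X Y r r') : Meet X Y r' r := by
  unfold Meet at *
  grind

/-- Invariant of the preparation: for the edges `1, …, i` the left vertices are computed; `rep v` is
the left vertex of the edges at the vertex `v`. -/
structure Prep (i : ℕ) (X Y K rep l c head nxt : ℕ → ℕ) : Prop where
  rep_fst : ∀ r, 1 ≤ r → r ≤ i → rep (X r) = l r
  rep_snd : ∀ r, 1 ≤ r → r ≤ i → rep (Y r) = l r
  exists_rep : ∀ v, rep v ≠ 0 → ∃ r, 1 ≤ r ∧ r ≤ i ∧ (X r = v ∨ Y r = v)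
  left : ∀ r, 1 ≤ r → r ≤ i → 1 ≤ l r ∧ l r ≤ r ∧ Meet X Y r (l r)
  color : ∀ r, 1 ≤ r → r ≤ i → c r = K r
  lists : Lists i l head nxt

namespace Prep

variable {i : ℕ} {X Y K rep : ℕ → ℕ}

theorem left_eq (h : Prep i X Y K rep l c head nxt) {r r' : ℕ} (hr : 1 ≤ r) (hi : r ≤ i)
    (hr' : 1 ≤ r') (hi' : r' ≤ i) (hm : Meet X Y r r') : l r = l r' := by
  have h1 := h.rep_fst r hr hi
  have h2 := h.rep_fst r' hr' hi'
  have h3 := h.rep_snd r hr hi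
  have h4 := h.rep_snd r' hr' hi'
  unfold Meet at hm
  grind

/-- Each edge meets the edge that names its class; transitivity then makes edges with the same name
meet. -/
theorem left_eq_iff (h : Prep m X Y K rep l c head nxt)
    (htrans : ∀ r₁ r₂ r₃, 1 ≤ r₁ → r₁ ≤ m → 1 ≤ r₂ → r₂ ≤ m → 1 ≤ r₃ → r₃ ≤ m →
      Meet X Y r₁ r₂ → Meet X Y r₂ r₃ → Meet X Y r₁ r₃)
    {r r' : ℕ} (hr : 1 ≤ r) (hi : r ≤ m) (hr' : 1 ≤ r') (hi' : r' ≤ m) :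
    l r = l r' ↔ Meet X Y r r' := by
  refine ⟨fun hl => ?_, h.left_eq hr hi hr' hi'⟩
  obtain ⟨h1, h2, h3⟩ := h.left r hr hi
  obtain ⟨h4, h5, h6⟩ := h.left r' hr' hi'
  exact htrans _ (l r) _ hr hi h1 (by omega) hr' hi' h3 (hl ▸ h6.symm)

theorem init : Prep 0 X Y K (fun _ => 0) (fun _ => 0) (fun _ => 0) (fun _ => 0) (fun _ => 0) where
  rep_fst := by omega
  rep_snd := by omega
  exists_rep := by simp
  left := by omega
  color := by omega
  lists := by constructor <;> simp <;> omega

/-- A new edge may touch old edges at both ends, but by transitivity these meet each other and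
already have the same name. No classes ever have to be merged. -/
theorem step (h : Prep i X Y K rep l c head nxt) (him : i < m)
    (htrans : ∀ r₁ r₂ r₃, 1 ≤ r₁ → r₁ ≤ m → 1 ≤ r₂ → r₂ ≤ m → 1 ≤ r₃ → r₃ ≤ m →
      Meet X Y r₁ r₂ → Meet X Y r₂ r₃ → Meet X Y r₁ r₃)
    {u : ℕ} (hu : (rep (X (i + 1)) ≠ 0 ∧ u = rep (X (i + 1))) ∨
      (rep (X (i + 1)) = 0 ∧ rep (Y (i + 1)) ≠ 0 ∧ u = rep (Y (i + 1))) ∨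
      (rep (X (i + 1)) = 0 ∧ rep (Y (i + 1)) = 0 ∧ u = i + 1)) :
    Prep (i + 1) X Y K (Function.update (Function.update rep (X (i + 1)) u) (Y (i + 1)) u)
      (Function.update l (i + 1) u) (Function.update c (i + 1) (K (i + 1)))
      (Function.update head u (i + 1)) (Function.update nxt (i + 1) (head u)) := by
  -- All earlier edges meeting the new one bear the name `u`, so overwriting `rep` at both ends is
  -- consistent with them.
  have key : ∀ r, 1 ≤ r → r ≤ i → Meet X Y (i + 1) r → l r = u := by
    intro r h1 h2 h3
    have h4 := (h.left r h1 h2).1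
    have h5 := h.rep_fst r h1 h2
    have h6 := h.rep_snd r h1 h2
    rcases hu with ⟨hx, rfl⟩ | ⟨hx, hy, rfl⟩ | ⟨hx, hy, rfl⟩
    · obtain ⟨r', h7, h8, h9⟩ := h.exists_rep _ hx
      have h10 : Meet X Y r' (i + 1) := by unfold Meet; grind
      rw [h.left_eq h1 h2 h7 h8
        (htrans _ _ _ h7 (by omega) (by omega) him h1 (by omega) h10 h3).symm]
      have h11 := h.rep_fst r' h7 h8
      have h12 := h.rep_snd r' h7 h8
      grind
    · unfold Meet at h3
      grind
    · unfold Meet at h3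
      grind
  have hleft : 1 ≤ u ∧ u ≤ i + 1 ∧ Meet X Y (i + 1) u := by
    have aux : ∀ v, rep v ≠ 0 → (v = X (i + 1) ∨ v = Y (i + 1)) →
        1 ≤ rep v ∧ rep v ≤ i + 1 ∧ Meet X Y (i + 1) (rep v) := by
      intro v hv hv'
      obtain ⟨r, h1, h2, h3⟩ := h.exists_rep v hv
      obtain ⟨h4, h5, h6⟩ := h.left r h1 h2
      have h7 : rep v = l r := by
        rcases h3 with rfl | rfl
        · exact h.rep_fst r h1 h2
        · exact h.rep_snd r h1 h2
      have h8 : Meet X Y (i + 1) r := by unfold Meet; grind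
      rw [h7]
      exact ⟨h4, by omega, htrans _ _ _ (by omega) him h1 (by omega) h4 (by omega) h8 h6⟩
    rcases hu with ⟨hx, rfl⟩ | ⟨hx, hy, rfl⟩ | ⟨hx, hy, rfl⟩
    · exact aux _ hx (.inl rfl)
    · exact aux _ hy (.inr rfl)
    · exact ⟨by omega, le_rfl, .inl rfl⟩
  refine ⟨fun r h1 h2 => ?_, fun r h1 h2 => ?_, fun v hv => ?_, fun r h1 h2 => ?_,
    fun r h1 h2 => ?_, h.lists.snoc hleft.1 hleft.2.1⟩
  · by_cases hr : r = i + 1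
    · subst hr
      simp only [Function.update_apply]
      grind
    · have h3 := key r h1 (by omega)
      have h4 := h.rep_fst r h1 (by omega)
      rw [Function.update_of_ne hr]
      simp only [Function.update_apply]
      unfold Meet at h3
      grind
  · by_cases hr : r = i + 1
    · subst hr
      simp only [Function.update_self]
    · have h3 := key r h1 (by omega)
      have h4 := h.rep_snd r h1 (by omega)
      rw [Function.update_of_ne hr]
      simp only [Function.update_apply]
      unfold Meet at h3
      grind
  · by_cases hx : v = X (i + 1)
    · exact ⟨i + 1, by omega, le_rfl, .inl hx.symm⟩
    by_cases hy : v = Y (i + 1)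
    · exact ⟨i + 1, by omega, le_rfl, .inr hy.symm⟩
    rw [Function.update_of_ne hy, Function.update_of_ne hx] at hv
    obtain ⟨r, h1, h2, h3⟩ := h.exists_rep v hv
    exact ⟨r, h1, by omega, h3⟩
  · by_cases hr : r = i + 1
    · subst hr
      rw [Function.update_self]
      exact hleft
    · rw [Function.update_of_ne hr]
      exact h.left r h1 (by omega)
  · by_cases hr : r = i + 1
    · subst hr
      rw [Function.update_self]
    · rw [Function.update_of_ne hr]
      exact h.color r h1 (by omega)

end Prep

open RainbowMatching.Expr RainbowMatching.Test RainbowMatching.Program in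
/-- Preparation for one edge: determine its left vertex and put it into the adjacency list. -/
def prepBody : Program :=
  block [assign 2 (succ (reg 2)),
    assign 3 (get 6 (get 0 (pred (reg 2)))),
    cond (eq (reg 3) (const 0)) (assign 3 (get 6 (get 1 (pred (reg 2))))) skip,
    cond (eq (reg 3) (const 0)) (assign 3 (reg 2)) skip,
    write 6 (get 0 (pred (reg 2))) (reg 3),
    write 6 (get 1 (pred (reg 2))) (reg 3),
    write 4 (reg 2) (reg 3),
    write 5 (reg 2) (get 2 (pred (reg 2))),
    write 8 (reg 2) (get 7 (reg 3)),
    write 7 (reg 3) (reg 2),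
    write 13 (reg 3) (reg 2)]

/-- The part of the memory that holds no data before the auction. -/
structure Blank (s : Store) : Prop where
  reg8 : s.reg 8 = 0
  reg11 : s.reg 11 = 0
  arr3 : s.arr 3 = fun _ => 0
  arr9 : s.arr 9 = fun _ => 0
  arr10 : s.arr 10 = fun _ => 0
  arr11 : s.arr 11 = fun _ => 0
  arr12 : s.arr 12 = fun _ => 0
  arr14 : s.arr 14 = fun _ => 0

/-- Invariant of the preparation loop. -/
structure PrepState (m : ℕ) (x y k : ℕ → ℕ) (s : Store) : Prop where
  reg1 : s.reg 1 = m
  reg2_le : s.reg 2 ≤ m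
  arr0 : s.arr 0 = x
  arr1 : s.arr 1 = y
  arr2 : s.arr 2 = k
  blank : Blank s
  prep : Prep (s.reg 2) (fun r => x (r - 1)) (fun r => y (r - 1)) (fun r => k (r - 1)) (s.arr 6)
    (s.arr 4) (s.arr 5) (s.arr 7) (s.arr 8)
  arr13 : s.arr 13 = s.arr 7

theorem prepBody_spec {m : ℕ} {x y k : ℕ → ℕ}
    (htrans : ∀ r₁ r₂ r₃, 1 ≤ r₁ → r₁ ≤ m → 1 ≤ r₂ → r₂ ≤ m → 1 ≤ r₃ → r₃ ≤ m →
      Meet (fun r => x (r - 1)) (fun r => y (r - 1)) r₁ r₂ →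
      Meet (fun r => x (r - 1)) (fun r => y (r - 1)) r₂ r₃ →
      Meet (fun r => x (r - 1)) (fun r => y (r - 1)) r₁ r₃)
    (s : Store) (h : PrepState m x y k s) (hb : countTest.eval s = true) :
    PrepState m x y k (prepBody.exec s) ∧ m - (prepBody.exec s).reg 2 < m - s.reg 2 := by
  obtain ⟨h1, h2, h3, h4, h5, ⟨b1, b2, b3, b4, b5, b6, b7, b8⟩, hP, h13⟩ := h
  have hi : s.reg 2 < m := by simpa [countTest, h1] using hb
  by_cases hx : s.arr 6 (x (s.reg 2)) = 0
  · by_cases hy : s.arr 6 (y (s.reg 2)) = 0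
    · have hS := hP.step hi htrans (u := s.reg 2 + 1) (.inr (.inr ⟨by simpa, by simpa, rfl⟩))
      simp [prepBody, h3, h4, h5, hx, hy]
      refine ⟨⟨?_, ?_, ?_, ?_, ?_, ⟨?_, ?_, ?_, ?_, ?_, ?_, ?_, ?_⟩, ?_, ?_⟩, ?_⟩
      all_goals try simp [h1, h3, h4, h5, b1, b2, b3, b4, b5, b6, b7, b8, h13]
      · omega
      · simpa using hS
      · omega
    · have hS := hP.step hi htrans (.inr (.inl ⟨by simpa, by simpa, rfl⟩))
      simp [prepBody, h3, h4, h5, hx, hy]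
      refine ⟨⟨?_, ?_, ?_, ?_, ?_, ⟨?_, ?_, ?_, ?_, ?_, ?_, ?_, ?_⟩, ?_, ?_⟩, ?_⟩
      all_goals try simp [h1, h3, h4, h5, b1, b2, b3, b4, b5, b6, b7, b8, h13]
      · omega
      · simpa using hS
      · omega
  · have hS := hP.step hi htrans (.inl ⟨by simpa, rfl⟩)
    simp [prepBody, h3, h4, h5, hx]
    refine ⟨⟨?_, ?_, ?_, ?_, ?_, ⟨?_, ?_, ?_, ?_, ?_, ?_, ?_, ?_⟩, ?_, ?_⟩, ?_⟩
    all_goals try simp [h1, h3, h4, h5, b1, b2, b3, b4, b5, b6, b7, b8, h13]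
    · omega
    · simpa using hS
    · omega

/-! ### Integer square root -/

open RainbowMatching.Expr RainbowMatching.Program in
/-- Reset the registers used by the computation of the square root. -/
def sqrtReset : Program :=
  block [assign 2 (const 0), assign 4 (const 0), assign 5 (const 0), assign 6 (const 0)]

open RainbowMatching.Expr RainbowMatching.Test RainbowMatching.Program in
/-- One step of the computation of the square root. -/
def sqrtBody : Program :=
  block [assign 2 (succ (reg 2)),
    cond (lt (reg 5) (reg 6)) (assign 5 (succ (reg 5)))
      (block [assign 5 (const 0), assign 4 (succ (reg 4)), assign 6 (succ (succ (reg 6)))])]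

/-- Invariant of the computation of the square root. -/
structure SqrtState (m : ℕ) (l c head nxt : ℕ → ℕ) (s : Store) : Prop where
  frame : Frame m l c head nxt s
  blank : Blank s
  arr13 : s.arr 13 = head
  reg2_le : s.reg 2 ≤ m
  reg6 : s.reg 6 = 2 * s.reg 4
  reg5_le : s.reg 5 ≤ s.reg 6
  reg2 : s.reg 2 = s.reg 4 * s.reg 4 + s.reg 5

theorem sqrtReset_spec (s : Store) (hF : Frame m l c head nxt s) (hB : Blank s)
    (h13 : s.arr 13 = head) : SqrtState m l c head nxt (sqrtReset.exec s) := by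
  obtain ⟨f1, f3, f4, f5, f7, f8⟩ := hF
  obtain ⟨b1, b2, b3, b4, b5, b6, b7, b8⟩ := hB
  simp only [sqrtReset, block, Program.exec, Expr.eval]
  refine ⟨⟨?_, ?_, ?_, ?_, ?_, ?_⟩, ⟨?_, ?_, ?_, ?_, ?_, ?_, ?_, ?_⟩, ?_, ?_, ?_, ?_, ?_⟩
  all_goals simp [*]

/-- With q in register `4` and the counter equal to q² + r for 0 ≤ r ≤ 2q, the next square is
reached exactly after r = 2q; no multiplication is needed. -/
theorem sqrtBody_spec (s : Store) (h : SqrtState m l c head nxt s)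
    (hb : countTest.eval s = true) :
    SqrtState m l c head nxt (sqrtBody.exec s) ∧
      m - (sqrtBody.exec s).reg 2 < m - s.reg 2 := by
  obtain ⟨⟨f1, f3, f4, f5, f7, f8⟩, ⟨b1, b2, b3, b4, b5, b6, b7, b8⟩, h13, h2, h6, h5, hq⟩ := h
  have hi : s.reg 2 < m := by simpa [countTest, f1] using hb
  by_cases h : s.reg 5 < s.reg 6
  · simp [sqrtBody, h]
    refine ⟨⟨⟨?_, ?_, ?_, ?_, ?_, ?_⟩, ⟨?_, ?_, ?_, ?_, ?_, ?_, ?_, ?_⟩, ?_, ?_, ?_, ?_, ?_⟩, ?_⟩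
    all_goals try simp [f1, f3, f4, f5, f7, f8, b1, b2, b4, b5, b6, b7, b8, h13]
    all_goals omega
  · simp [sqrtBody, h]
    refine ⟨⟨⟨?_, ?_, ?_, ?_, ?_, ?_⟩, ⟨?_, ?_, ?_, ?_, ?_, ?_, ?_, ?_⟩, ?_, ?_, ?_, ?_, ?_⟩, ?_⟩
    all_goals try simp [f1, f3, f4, f5, f7, f8, b1, b2, b4, b5, b6, b7, b8, h13]
    all_goals first | omega | skip
    rw [hq]
    have : s.reg 5 = 2 * s.reg 4 := by omega
    rw [this]
    ring

open RainbowMatching.Expr RainbowMatching.Program in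
/-- Computation of the integer square root of the number of edges. -/
def sqrtProgram : Program :=
  seq sqrtReset (seq (loop countTest sqrtBody) (assign 2 (const 0)))

theorem sqrtProgram_spec (hL : Lists m l head nxt) :
    Computes sqrtProgram (fun s => Frame m l c head nxt s ∧ Blank s ∧ s.arr 13 = head)
      (fun s => AuctionState m (Nat.sqrt m + 1) l c head nxt s ∧
        auctionPotential m (Nat.sqrt m + 1) s ≤ 2 * (m * (Nat.sqrt m + 1)) + 2 * m)
      (100 * (m + 1)) := by
  have h1 : Computes sqrtReset (fun s => Frame m l c head nxt s ∧ Blank s ∧ s.arr 13 = head)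
      (fun s => SqrtState m l c head nxt s ∧ m - s.reg 2 ≤ m) _ :=
    Computes.exec rfl fun s hs => ⟨sqrtReset_spec s hs.1 hs.2.1 hs.2.2, Nat.sub_le _ _⟩
  have h2 := Computes.loop_exec (I := SqrtState m l c head nxt) (fun s => m - s.reg 2)
    (N := m) rfl sqrtBody_spec
  have h3 : Computes (.assign 2 (.const 0))
      (fun s => SqrtState m l c head nxt s ∧ countTest.eval s = false)
      (fun s => AuctionState m (Nat.sqrt m + 1) l c head nxt s ∧
        auctionPotential m (Nat.sqrt m + 1) s ≤ 2 * (m * (Nat.sqrt m + 1)) + 2 * m) 2 := by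
    refine Computes.exec rfl fun s hs => ?_
    obtain ⟨⟨⟨f1, f3, f4, f5, f7, f8⟩, ⟨b1, b2, b3, b4, b5, b6, b7, b8⟩, h13, h2, h6, h5, hq⟩,
      hb⟩ := hs
    have hi : s.reg 2 = m := by
      have h1 : m ≤ s.reg 2 := by simpa [countTest, f1] using hb
      omega
    have hs : s.reg 4 = Nat.sqrt m := Nat.eq_sqrt.2 ⟨by omega, by rw [← hi, hq]; nlinarith⟩
    refine ⟨⟨⟨?_, ?_, ?_, ?_, ?_, ?_⟩, ?_, ?_, ?_, ?_⟩, ?_⟩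
    all_goals simp [auctionPotential, f1, f3, f4, f5, f7, f8, b1, b2, b4, b5, b6, b7, b8, h13,
      hs]
    · exact Auction.init hL
  refine (h1.seq (h2.seq h3)).mono (fun _ h => h) (fun _ h => h) ?_
  simp [sqrtReset, sqrtBody, countTest, block, Program.maxCost, Expr.cost, Test.cost]
  omega

variable {owner : ℕ → ℕ}

/-! ### The main loop -/

theorem AuctionState.phaseState {k : ℕ} (hL : Lists m l head nxt) {s : Store}
    (h : AuctionState m k l c head nxt s) (hb : auctionTest.eval s = false) :
    PhaseState m (matched m c (s.arr 11)).card l c head nxt (s.setReg 16 1) ∧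
      ∀ S : Finset ℕ, S ⊆ Finset.Icc 1 m → Set.InjOn l (S : Set ℕ) →
        Set.InjOn c (S : Set ℕ) → k * S.card ≤ (k + 1) * (matched m c (s.arr 11)).card := by
  obtain ⟨⟨f1, f3, f4, f5, f7, f8⟩, h4, hA, h11, h14⟩ := h
  simp [auctionTest, f1] at hb
  have h2 : s.reg 2 = m := by
    have := hA.le
    omega
  refine ⟨⟨⟨by simpa, by simpa, by simpa, by simpa, by simpa, by simpa⟩, ?_, ?_, ?_, ?_, ?_, ?_⟩, ?_⟩
  · simpa using hA.isMate
  · simp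
  · simp [h14]
  · simpa using hA.cur_le
  · simpa using hA.cur_left
  · simp
  · rw [h2, hb.2] at hA
    exact fun S => hA.mul_card_le hL

open RainbowMatching.Expr RainbowMatching.Test in
/-- Test of the main loop. -/
def mainTest : Test := lt (const 0) (reg 16)

/-- Invariant of the main loop: the matching lacks less than `k` of the `D` edges of a maximum
matching. -/
def MainState (m D k : ℕ) (l c head nxt : ℕ → ℕ) (s : Store) : Prop :=
  (∃ N, PhaseState m N l c head nxt s ∧ D < N + k) ∨ (s.reg 16 = 0 ∧ Optimal m l c head nxt s)

/-- Potential of the main loop. -/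
def mainPotential (m D : ℕ) (c : ℕ → ℕ) (s : Store) : ℕ :=
  if s.reg 16 = 0 then 0 else D - (matched m c (s.arr 11)).card + 1

theorem PhaseState.card_le {N D : ℕ} {s : Store} (h : PhaseState m N l c head nxt s)
    (hD : ∀ S : Finset ℕ, S ⊆ Finset.Icc 1 m → Set.InjOn l (S : Set ℕ) →
      Set.InjOn c (S : Set ℕ) → S.card ≤ D) : N ≤ D := by
  rw [← h.card]
  exact hD _ (Finset.filter_subset _ _) h.isMate.injOn_left h.isMate.injOn_color

open RainbowMatching.Program in
/-- Computation of a maximum matching from the adjacency lists. -/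
def matchingProgram : Program :=
  seq sqrtProgram (seq (loop auctionTest auctionBody)
    (seq (assign 16 (Expr.const 1)) (loop mainTest phase)))

/-- The auction costs a constant times (m + 1)k. It leaves a deficit below `k`, so at most `k`
linear phases follow, the last unsuccessful one included. -/
theorem matchingProgram_spec (hL : Lists m l head nxt) :
    Computes matchingProgram (fun s => Frame m l c head nxt s ∧ Blank s ∧ s.arr 13 = head)
      (Optimal m l c head nxt) (1000 * (m + 1) * (Nat.sqrt m + 1)) := by
  set k := Nat.sqrt m + 1 with hk
  obtain ⟨S₀, ⟨hS1, hS2, hS3⟩, hD⟩ : ∃ S₀ : Finset ℕ, (S₀ ⊆ Finset.Icc 1 m ∧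
      Set.InjOn l (S₀ : Set ℕ) ∧ Set.InjOn c (S₀ : Set ℕ)) ∧ ∀ S : Finset ℕ,
      S ⊆ Finset.Icc 1 m → Set.InjOn l (S : Set ℕ) → Set.InjOn c (S : Set ℕ) →
      S.card ≤ S₀.card := by
    classical
    obtain ⟨S₀, h1, h2⟩ := Finset.exists_max_image
      ((Finset.Icc 1 m).powerset.filter fun S : Finset ℕ =>
        Set.InjOn l (S : Set ℕ) ∧ Set.InjOn c (S : Set ℕ)) Finset.card ⟨∅, by simp⟩
    simp only [Finset.mem_filter, Finset.mem_powerset] at h1 h2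
    exact ⟨S₀, h1, fun S a b d => h2 S ⟨a, b, d⟩⟩
  have h1 := sqrtProgram_spec (c := c) hL
  rw [← hk] at h1
  have h2 := Computes.loop_exec (N := 2 * (m * k) + 2 * m) (auctionPotential m k) rfl
    (auctionBody_spec (c := c) hL)
  have h3 : Computes (.assign 16 (.const 1))
      (fun s => AuctionState m k l c head nxt s ∧ auctionTest.eval s = false)
      (fun s => MainState m S₀.card k l c head nxt s ∧ mainPotential m S₀.card c s ≤ k) 2 := by
    refine Computes.exec rfl fun s hs => ?_
    obtain ⟨h, h'⟩ := hs.1.phaseState hL hs.2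
    have h'' := h' S₀ hS1 hS2 hS3
    have hN := hD _ (Finset.filter_subset _ _) h.isMate.injOn_left h.isMate.injOn_color
    have hm : S₀.card ≤ m := by simpa using Finset.card_le_card hS1
    -- Otherwise k(N + k) ≤ k·D ≤ (k + 1)N, hence k² ≤ N ≤ m, contradicting m < k².
    have hlt : S₀.card < (matched m c (s.arr 11)).card + k := by
      have h4 : m < k * k := Nat.lt_succ_sqrt m
      have h5 : (matched m c (s.arr 11)).card ≤ m := hN.trans hm
      by_contra hcon
      have h6 := Nat.mul_le_mul_left k (not_lt.1 hcon)
      rw [mul_add] at h6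
      rw [Nat.succ_mul k] at h''
      omega
    refine ⟨.inl ⟨_, h, hlt⟩, ?_⟩
    simp [mainPotential]
    omega
  have h4 := Computes.loop (p := phase) (b := mainTest) (I := MainState m S₀.card k l c head nxt)
    (N := k) (B := 400 * (m + 1)) (mainPotential m S₀.card c) (by
      intro s hs hb
      have h16 : 0 < s.reg 16 := by simpa [mainTest] using hb
      obtain ⟨N, hP, hlt⟩ := hs.resolve_right (by omega)
      have hN := hP.card_le hD
      obtain ⟨s', t, r, h, ht⟩ := phase_spec hL N s hP
      refine ⟨s', t, r, ?_, ht⟩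
      have hpos : mainPotential m S₀.card c s = S₀.card - N + 1 := by
        simp [mainPotential, hP.card, hP.reg16]
      rw [hpos]
      rcases h with h | h
      · have hN' := h.card_le hD
        refine ⟨.inl ⟨_, h, by omega⟩, ?_⟩
        simp [mainPotential, h.card, h.reg16]
        omega
      · exact ⟨.inr h, by simp [mainPotential, h.1]⟩)
  have h5 := h4.mono (fun _ h => h) (Q' := Optimal m l c head nxt) (fun s hs => by
    have h16 : s.reg 16 = 0 := by simpa [mainTest] using hs.2
    rcases hs.1 with ⟨N, h, -⟩ | h
    · have := h.reg16
      omega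
    · exact h.2) le_rfl
  refine (h1.seq (h2.seq (h3.seq h5))).mono (fun _ h => h) (fun _ h => h) ?_
  simp [auctionBody, auctionTest, mainTest, block, Program.maxCost, Expr.cost, Test.cost]
  have hk1 : 1 ≤ k := by omega
  have hmk : m ≤ m * k := Nat.le_mul_of_pos_right m hk1
  nlinarith

/-! ### Output -/

open RainbowMatching.Expr RainbowMatching.Test RainbowMatching.Program in
/-- Output for one edge. -/
def outputBody : Program :=
  block [assign 2 (succ (reg 2)),
    cond (eq (get 11 (get 5 (reg 2))) (reg 2)) (write 3 (pred (reg 2)) (const 1)) skip]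

/-- Invariant of the output loop. -/
structure OutputState (m : ℕ) (c owner : ℕ → ℕ) (s : Store) : Prop where
  reg1 : s.reg 1 = m
  arr5 : s.arr 5 = c
  arr11 : s.arr 11 = owner
  out : ∀ r, 1 ≤ r → r ≤ s.reg 2 → (s.arr 3 (r - 1) = 1 ↔ owner (c r) = r)
  blank : ∀ r, s.reg 2 ≤ r → s.arr 3 r = 0
  reg2_le : s.reg 2 ≤ m

theorem outputBody_spec (s : Store) (h : OutputState m c owner s)
    (hb : countTest.eval s = true) :
    OutputState m c owner (outputBody.exec s) ∧
      m - (outputBody.exec s).reg 2 < m - s.reg 2 := by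
  obtain ⟨h1, h5, h11, ho, hB, h2⟩ := h
  have hi : s.reg 2 < m := by simpa [countTest, h1] using hb
  by_cases h : owner (c (s.reg 2 + 1)) = s.reg 2 + 1
  · simp [outputBody, h5, h11, h]
    refine ⟨⟨by simpa, by simpa, by simpa, fun r hr1 hr2 => ?_, fun r hr => ?_, by simpa⟩,
      by simpa using by omega⟩
    · simp at hr2
      by_cases hr : r = s.reg 2 + 1
      · simp [hr, h]
      · have := ho r hr1 (by omega)
        have hne : r - 1 ≠ s.reg 2 := by omega
        simpa [Function.update_of_ne hne] using this
    · simp at hr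
      have hne : r ≠ s.reg 2 := by omega
      simpa [Function.update_of_ne hne] using hB r (by omega)
  · simp [outputBody, h5, h11, h]
    refine ⟨⟨by simpa, by simpa, by simpa, fun r hr1 hr2 => ?_, fun r hr => ?_, by simpa⟩,
      by simpa using by omega⟩
    · simp at hr2
      by_cases hr : r = s.reg 2 + 1
      · subst hr
        simp [h, hB (s.reg 2) le_rfl]
      · simpa using ho r hr1 (by omega)
    · simp at hr
      simpa using hB r (by omega)

open RainbowMatching.Program in
/-- Output of the matching. -/
def outputProgram : Program :=
  seq (assign 2 (Expr.const 0)) (loop countTest outputBody)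

theorem outputProgram_spec :
    Computes outputProgram
      (fun s => s.reg 1 = m ∧ s.arr 3 = (fun _ => 0) ∧ s.arr 5 = c ∧ s.arr 11 = owner)
      (fun s => ∀ r, 1 ≤ r → r ≤ m → (s.arr 3 (r - 1) = 1 ↔ owner (c r) = r))
      (100 * (m + 1)) := by
  have h1 : Computes (.assign 2 (Expr.const 0))
      (fun s => s.reg 1 = m ∧ s.arr 3 = (fun _ => 0) ∧ s.arr 5 = c ∧ s.arr 11 = owner)
      (fun s => OutputState m c owner s ∧ m - s.reg 2 ≤ m) 2 := by
    refine Computes.exec rfl fun s hs => ?_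
    obtain ⟨h1, h3, h5, h11⟩ := hs
    refine ⟨⟨by simpa, by simpa, by simpa, fun r hr1 hr2 => ?_, ?_, by simp⟩, by simp⟩
    · simp at hr2
      omega
    · simp [h3]
  have h2 := Computes.loop_exec (I := OutputState m c owner) (fun s => m - s.reg 2) (N := m) rfl
    outputBody_spec
  refine (h1.seq h2).mono (fun _ h => h) (fun s hs r hr1 hr2 => ?_) ?_
  · have h3 := hs.1.reg1
    have h4 := hs.2
    simp [countTest, h3] at h4
    exact hs.1.out r hr1 (by omega)
  · simp [outputBody, countTest, block, Program.maxCost, Expr.cost, Test.cost]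
    omega

/-! ### The program -/

/-- Edges no two of which have a common endvertex or the same color. -/
def Independent (X Y K : ℕ → ℕ) (S : Finset ℕ) : Prop :=
  ∀ r ∈ S, ∀ r' ∈ S, Meet X Y r r' ∨ K r = K r' → r = r'

open RainbowMatching.Program in
/-- The program computing a maximum rainbow matching. -/
def rainbowProgram : Program :=
  seq (loop countTest prepBody) (seq matchingProgram outputProgram)

theorem rainbowProgram_spec {x y k : ℕ → ℕ}
    (htrans : ∀ r₁ r₂ r₃, 1 ≤ r₁ → r₁ ≤ m → 1 ≤ r₂ → r₂ ≤ m → 1 ≤ r₃ → r₃ ≤ m →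
      Meet (fun r => x (r - 1)) (fun r => y (r - 1)) r₁ r₂ →
      Meet (fun r => x (r - 1)) (fun r => y (r - 1)) r₂ r₃ →
      Meet (fun r => x (r - 1)) (fun r => y (r - 1)) r₁ r₃)
    (s : Store) (h1 : s.reg 1 = m) (hr : ∀ i, 2 ≤ i → s.reg i = 0) (hx : s.arr 0 = x)
    (hy : s.arr 1 = y) (hk : s.arr 2 = k) (ha : ∀ i, 3 ≤ i → s.arr i = fun _ => 0) :
    ∃ s' t, Runs rainbowProgram s s' t ∧ t ≤ 1500 * (m + 1) * (Nat.sqrt m + 1) ∧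
      ∃ M : Finset ℕ, M ⊆ Finset.Icc 1 m ∧
        (∀ r, 1 ≤ r → r ≤ m → (s'.arr 3 (r - 1) = 1 ↔ r ∈ M)) ∧
        Independent (fun r => x (r - 1)) (fun r => y (r - 1)) (fun r => k (r - 1)) M ∧
        ∀ S : Finset ℕ, S ⊆ Finset.Icc 1 m →
          Independent (fun r => x (r - 1)) (fun r => y (r - 1)) (fun r => k (r - 1)) S →
          S.card ≤ M.card := by
  have hprep := Computes.loop_exec (I := PrepState m x y k) (fun s => m - s.reg 2) (N := m) rfl
    (prepBody_spec htrans)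
  obtain ⟨s₁, t₁, r₁, ⟨hP, hb⟩, l₁⟩ := hprep s ⟨⟨h1, by rw [hr 2 le_rfl]; omega, hx, hy, hk,
    ⟨hr _ (by omega), hr _ (by omega), ha _ (by omega), ha _ (by omega), ha _ (by omega),
      ha _ (by omega), ha _ (by omega), ha _ (by omega)⟩,
    by simpa [hr 2 le_rfl, ha] using Prep.init, by simp [ha]⟩, Nat.sub_le _ _⟩
  have hi : s₁.reg 2 = m := by
    have h2 : m ≤ s₁.reg 2 := by simpa [countTest, hP.reg1] using hb
    have := hP.reg2_le
    omega
  have hp := hP.prep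
  rw [hi] at hp
  obtain ⟨s₂, t₂, r₂, hO, l₂⟩ := matchingProgram_spec (c := s₁.arr 5) hp.lists s₁
    ⟨⟨hP.reg1, hP.blank.arr3, rfl, rfl, rfl, rfl⟩, hP.blank, hP.arr13⟩
  obtain ⟨s₃, t₃, r₃, hout, l₃⟩ := outputProgram_spec s₂
    ⟨hO.frame.reg1, hO.frame.arr3, hO.frame.arr5, rfl⟩
  -- The reduction itself: vertex-disjoint and differently colored edges are those with distinct
  -- left vertices and distinct colors.
  have hind : ∀ S : Finset ℕ, S ⊆ Finset.Icc 1 m →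
      (Independent (fun r => x (r - 1)) (fun r => y (r - 1)) (fun r => k (r - 1)) S ↔
        Set.InjOn (s₁.arr 4) (S : Set ℕ) ∧ Set.InjOn (s₁.arr 5) (S : Set ℕ)) := by
    intro S hS
    have hmem : ∀ r ∈ S, 1 ≤ r ∧ r ≤ m := fun r hr => Finset.mem_Icc.1 (hS hr)
    constructor
    · intro h
      refine ⟨fun r hr r' hr' he => h r hr r' hr' (.inl ?_),
        fun r hr r' hr' he => h r hr r' hr' (.inr ?_)⟩
      · exact (hp.left_eq_iff htrans (hmem r hr).1 (hmem r hr).2 (hmem r' hr').1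
          (hmem r' hr').2).1 he
      · rwa [hp.color r (hmem r hr).1 (hmem r hr).2, hp.color r' (hmem r' hr').1
          (hmem r' hr').2] at he
    · rintro ⟨h2, h3⟩ r hr r' hr' (h | h)
      · exact h2 hr hr' ((hp.left_eq_iff htrans (hmem r hr).1 (hmem r hr).2 (hmem r' hr').1
          (hmem r' hr').2).2 h)
      · exact h3 hr hr' (by
          rwa [hp.color r (hmem r hr).1 (hmem r hr).2, hp.color r' (hmem r' hr').1
            (hmem r' hr').2])
  have hsub : matched m (s₁.arr 5) (s₂.arr 11) ⊆ Finset.Icc 1 m := Finset.filter_subset _ _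
  refine ⟨s₃, _, .seq r₁ (.seq r₂ r₃), ?_, matched m (s₁.arr 5) (s₂.arr 11), hsub, ?_, ?_, ?_⟩
  · simp [prepBody, countTest, block, Program.maxCost, Expr.cost, Test.cost] at l₁
    have : m + 1 ≤ (m + 1) * (Nat.sqrt m + 1) := Nat.le_mul_of_pos_right _ (by omega)
    nlinarith
  · intro r hr1 hr2
    rw [hout r hr1 hr2, mem_matched]
    exact ⟨fun h => ⟨⟨hr1, hr2⟩, h⟩, fun h => h.2⟩
  · exact (hind _ hsub).2 ⟨hO.isMate.injOn_left, hO.isMate.injOn_color⟩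
  · intro S hS hI
    obtain ⟨h2, h3⟩ := (hind S hS).1 hI
    exact hO.card_le S hS h2 h3

/-! ### Graphs without a path on four vertices -/

/-- In a graph without a path on four vertices, the edges meeting a common edge meet. -/
theorem exists_common_vertex {V : Type*} {G : SimpleGraph V} (hG : (SimpleGraph.pathGraph 4).Free G)
    {e f g : Sym2 V} (he : e ∈ G.edgeSet) (hf : f ∈ G.edgeSet) (hg : g ∈ G.edgeSet)
    (hef : ∃ v, v ∈ e ∧ v ∈ f) (hfg : ∃ v, v ∈ f ∧ v ∈ g) : ∃ v, v ∈ e ∧ v ∈ g := by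
  by_contra hcon
  push Not at hcon
  obtain ⟨b, hbe, hbf⟩ := hef
  obtain ⟨c, hcf, hcg⟩ := hfg
  obtain ⟨a, rfl⟩ := Sym2.mem_iff_exists.1 hbe
  obtain ⟨d, rfl⟩ := Sym2.mem_iff_exists.1 hcg
  -- The middle edge joins `b` and `c`, so disjointness of the outer edges `ab` and `cd` leaves four
  -- distinct vertices on the path `a, b, c, d`.
  have hbc : b ≠ c := fun h => hcon c (h ▸ hbe) hcg
  rw [(Sym2.mem_and_mem_iff hbc).1 ⟨hbf, hcf⟩] at hf
  rw [SimpleGraph.mem_edgeSet] at he hf hg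
  have hac : a ≠ c := fun h => hcon a (by simp) (by simp [h])
  have had : a ≠ d := fun h => hcon a (by simp) (by simp [h])
  have hbd : b ≠ d := fun h => hcon b (by simp) (by simp [h])
  have hab := he.ne
  have hcd := hg.ne
  refine hG ⟨⟨⟨![a, b, c, d], ?_⟩, ?_⟩⟩
  · intro i j hij
    rw [SimpleGraph.pathGraph_adj] at hij
    fin_cases i <;> fin_cases j <;> simp_all [SimpleGraph.adj_comm]
  · intro i j hij
    fin_cases i <;> fin_cases j <;> simp_all

namespace EdgeListing

variable {n : ℕ} {G : SimpleGraph (Fin n)} (L : EdgeListing G) (φ : G.EdgeLabeling ℕ)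

theorem edge_injective : Function.Injective L.edge := L.bijective.1

theorem edge_surjective : Function.Surjective L.edge := L.bijective.2

theorem input_arr_zero (i : Fin G.edgeSet.ncard) : (L.input φ).arr 0 i = L.fst i := by
  simp [input]

theorem input_arr_one (i : Fin G.edgeSet.ncard) : (L.input φ).arr 1 i = L.snd i := by
  simp [input]

theorem input_arr_two (i : Fin G.edgeSet.ncard) : (L.input φ).arr 2 i = φ (L.edge i) := by
  simp [input]

theorem meet_iff (i j : Fin G.edgeSet.ncard) :
    Meet (fun r => (L.input φ).arr 0 (r - 1)) (fun r => (L.input φ).arr 1 (r - 1)) (i + 1) (j + 1) ↔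
      ∃ v, v ∈ (L.edge i : Sym2 (Fin n)) ∧ v ∈ (L.edge j : Sym2 (Fin n)) := by
  simp only [Meet, Nat.add_sub_cancel, input_arr_zero, input_arr_one, edge, Sym2.mem_iff,
    Fin.val_inj]
  constructor
  · rintro (h | h | h | h)
    · exact ⟨_, .inl rfl, .inl h⟩
    · exact ⟨_, .inl rfl, .inr h⟩
    · exact ⟨_, .inr rfl, .inl h⟩
    · exact ⟨_, .inr rfl, .inr h⟩
  · rintro ⟨v, rfl | rfl, h | h⟩ <;> simp [h]

theorem exists_index {r : ℕ} (h1 : 1 ≤ r) (h2 : r ≤ G.edgeSet.ncard) :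
    ∃ i : Fin G.edgeSet.ncard, r = i + 1 :=
  ⟨⟨r - 1, by omega⟩, by simp; omega⟩

theorem meet_trans (hG : (SimpleGraph.pathGraph 4).Free G) (r₁ r₂ r₃ : ℕ)
    (h1 : 1 ≤ r₁) (h2 : r₁ ≤ G.edgeSet.ncard) (h3 : 1 ≤ r₂) (h4 : r₂ ≤ G.edgeSet.ncard)
    (h5 : 1 ≤ r₃) (h6 : r₃ ≤ G.edgeSet.ncard)
    (h12 : Meet (fun r => (L.input φ).arr 0 (r - 1)) (fun r => (L.input φ).arr 1 (r - 1)) r₁ r₂)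
    (h23 : Meet (fun r => (L.input φ).arr 0 (r - 1)) (fun r => (L.input φ).arr 1 (r - 1)) r₂ r₃) :
    Meet (fun r => (L.input φ).arr 0 (r - 1)) (fun r => (L.input φ).arr 1 (r - 1)) r₁ r₃ := by
  obtain ⟨i, rfl⟩ := exists_index h1 h2
  obtain ⟨j, rfl⟩ := exists_index h3 h4
  obtain ⟨k, rfl⟩ := exists_index h5 h6
  rw [meet_iff] at *
  exact exists_common_vertex hG (L.edge i).2 (L.edge j).2 (L.edge k).2 h12 h23

/-- The subgraph formed by the listed edges with numbers in `M`, counted from `1`. -/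
def subgraph (M : Finset ℕ) : G.Subgraph where
  verts := {v | ∃ i : Fin G.edgeSet.ncard, (i : ℕ) + 1 ∈ M ∧ v ∈ (L.edge i : Sym2 (Fin n))}
  Adj v w := ∃ i : Fin G.edgeSet.ncard, (i : ℕ) + 1 ∈ M ∧ (L.edge i : Sym2 (Fin n)) = s(v, w)
  adj_sub := by
    rintro v w ⟨i, -, h⟩
    have := (L.edge i).2
    rwa [h] at this
  edge_vert := by
    rintro v w ⟨i, h1, h2⟩
    exact ⟨i, h1, by rw [h2]; simp⟩
  symm := ⟨by
    rintro v w ⟨i, h1, h2⟩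
    exact ⟨i, h1, by rw [h2, Sym2.eq_swap]⟩⟩

theorem mem_edgeSet_subgraph {M : Finset ℕ} {e : Sym2 (Fin n)} :
    e ∈ (L.subgraph M).edgeSet ↔
      ∃ i : Fin G.edgeSet.ncard, (i : ℕ) + 1 ∈ M ∧ (L.edge i : Sym2 (Fin n)) = e := by
  induction e with
  | _ v w => rfl

theorem edge_mem_subgraph {M : Finset ℕ} {i : Fin G.edgeSet.ncard} :
    (L.edge i : Sym2 (Fin n)) ∈ (L.subgraph M).edgeSet ↔ (i : ℕ) + 1 ∈ M := by
  rw [mem_edgeSet_subgraph]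
  constructor
  · rintro ⟨j, hj, h⟩
    rwa [← L.edge_injective (Subtype.ext h)]
  · exact fun h => ⟨i, h, rfl⟩

theorem ncard_edgeSet (M : G.Subgraph) {S : Finset ℕ} (hS : S ⊆ Finset.Icc 1 G.edgeSet.ncard)
    (h : ∀ i : Fin G.edgeSet.ncard, (L.edge i : Sym2 (Fin n)) ∈ M.edgeSet ↔ (i : ℕ) + 1 ∈ S) :
    M.edgeSet.ncard = S.card := by
  symm
  rw [← Set.ncard_coe_finset]
  refine Set.ncard_congr
    (fun r hr => (L.edge ⟨r - 1, by have := Finset.mem_Icc.1 (hS hr); omega⟩ : Sym2 (Fin n)))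
    (fun r hr => ?_) (fun r r' hr hr' he => ?_) (fun e he => ?_)
  · have := Finset.mem_Icc.1 (hS hr)
    rw [h]
    simpa [Nat.sub_add_cancel this.1] using hr
  · have h1 := Finset.mem_Icc.1 (hS hr)
    have h2 := Finset.mem_Icc.1 (hS hr')
    have := L.edge_injective (Subtype.ext he)
    simp only [Fin.mk.injEq] at this
    omega
  · obtain ⟨i, hi⟩ := L.edge_surjective ⟨e, M.edgeSet_subset he⟩
    have hi' : (L.edge i : Sym2 (Fin n)) = e := by rw [hi]
    exact ⟨i + 1, (h i).1 (hi' ▸ he), by simpa using hi'⟩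

/-- The hypothesis `hv` excludes isolated vertices of `M`, which the edge set cannot detect but
`IsMatching` forbids. The shift by one reflects that the program numbers edges from 1, keeping 0 for
"none". -/
theorem isRainbowMatching_iff (M : G.Subgraph) {S : Finset ℕ}
    (hS : S ⊆ Finset.Icc 1 G.edgeSet.ncard)
    (h : ∀ i : Fin G.edgeSet.ncard, (L.edge i : Sym2 (Fin n)) ∈ M.edgeSet ↔ (i : ℕ) + 1 ∈ S)
    (hv : ∀ v ∈ M.verts, ∃ w, M.Adj v w) :
    IsRainbowMatching φ M ↔ Independent (fun r => (L.input φ).arr 0 (r - 1))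
      (fun r => (L.input φ).arr 1 (r - 1)) (fun r => (L.input φ).arr 2 (r - 1)) S := by
  have hadj : ∀ v w, M.Adj v w → ∃ i : Fin G.edgeSet.ncard, (i : ℕ) + 1 ∈ S ∧
      (L.edge i : Sym2 (Fin n)) = s(v, w) := by
    intro v w hvw
    obtain ⟨i, hi⟩ := L.edge_surjective ⟨s(v, w), M.edgeSet_subset hvw⟩
    have hi' : (L.edge i : Sym2 (Fin n)) = s(v, w) := by rw [hi]
    exact ⟨i, (h i).1 (by rw [hi']; exact hvw), hi'⟩
  constructor
  · rintro ⟨hM, hφ⟩ r hr r' hr' hrr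
    obtain ⟨i, rfl⟩ := exists_index (Finset.mem_Icc.1 (hS hr)).1 (Finset.mem_Icc.1 (hS hr)).2
    obtain ⟨j, rfl⟩ := exists_index (Finset.mem_Icc.1 (hS hr')).1 (Finset.mem_Icc.1 (hS hr')).2
    rw [← h] at hr hr'
    rcases hrr with hrr | hrr
    · obtain ⟨v, h1, h2⟩ := (L.meet_iff φ i j).1 hrr
      obtain ⟨w, h3⟩ := Sym2.mem_iff_exists.1 h1
      obtain ⟨w', h4⟩ := Sym2.mem_iff_exists.1 h2
      rw [h3] at hr
      rw [h4] at hr'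
      have : w = w' := hM.eq_of_adj_left hr hr'
      subst this
      rw [L.edge_injective (Subtype.ext (h3.trans h4.symm))]
    · simp only [Nat.add_sub_cancel, input_arr_two] at hrr
      rw [L.edge_injective (hφ hr hr' hrr)]
  · intro hI
    refine ⟨fun v hvM => ?_, fun e he f hf hef => ?_⟩
    · obtain ⟨w, hw⟩ := hv v hvM
      refine ⟨w, hw, fun w' hw' => ?_⟩
      obtain ⟨i, h1, h2⟩ := hadj v w hw
      obtain ⟨j, h3, h4⟩ := hadj v w' hw'
      have := hI _ h3 _ h1 (.inl ((L.meet_iff φ j i).2 ⟨v, by simp [h4], by simp [h2]⟩))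
      have hij : j = i := Fin.ext (by omega)
      subst hij
      exact Sym2.congr_right.1 (h4.symm.trans h2)
    · obtain ⟨i, rfl⟩ := L.edge_surjective e
      obtain ⟨j, rfl⟩ := L.edge_surjective f
      have := hI _ ((h i).1 he) _ ((h j).1 hf)
        (.inr (by simpa only [Nat.add_sub_cancel, input_arr_two] using hef))
      have hij : i = j := Fin.ext (by omega)
      rw [hij]

end EdgeListing

/-! ### The exponent 3/2 and the conclusion -/

theorem mul_sqrt_le_rpow (m : ℕ) :
    (((m + 1) * (Nat.sqrt m + 1) : ℕ) : ℝ) ≤ 4 * ((max 1 m : ℕ) : ℝ) ^ (3 / 2 : ℝ) := by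
  set M := max 1 m with hM
  have h1 : 1 ≤ M := le_max_left _ _
  have h2 : m ≤ M := le_max_right _ _
  have h3 : (1 : ℝ) ≤ M := by exact_mod_cast h1
  have h4 : ((M : ℕ) : ℝ) ^ (3 / 2 : ℝ) = M * √(M : ℝ) := by
    rw [Real.sqrt_eq_rpow, ← Real.rpow_one_add' (by positivity) (by norm_num)]
    norm_num
  have h5 : (Nat.sqrt m : ℝ) ≤ √(M : ℝ) :=
    Real.nat_sqrt_le_real_sqrt.trans (Real.sqrt_le_sqrt (by exact_mod_cast h2))
  have h6 : 1 ≤ √(M : ℝ) := Real.one_le_sqrt.2 h3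
  have h7 : (m : ℝ) ≤ M := by exact_mod_cast h2
  rw [h4]
  push_cast
  calc ((m : ℝ) + 1) * (Nat.sqrt m + 1) ≤ (2 * M) * (2 * √(M : ℝ)) := by
        gcongr <;> linarith
    _ = 4 * (M * √(M : ℝ)) := by ring

end RainbowMatching

theorem theorem4p1 :
    ∃ (P : RainbowMatching.Program) (C : ℝ),
      ∀ (n : ℕ) (G : SimpleGraph (Fin n)), (SimpleGraph.pathGraph 4).Free G →
        ∀ (φ : G.EdgeLabeling ℕ) (L : RainbowMatching.EdgeListing G),
          ∃ (s : RainbowMatching.Store) (t : ℕ),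
            RainbowMatching.Runs P (L.input φ) s t ∧
            (∃ M : G.Subgraph,
              RainbowMatching.IsMaxRainbowMatching φ M ∧ M.edgeSet = L.output s) ∧
            (t : ℝ) ≤ C * ((max 1 G.edgeSet.ncard : ℕ) : ℝ) ^ (3 / 2 : ℝ) := by
  -- The constant is `1500 * 4`, from `rainbowProgram_spec` and `mul_sqrt_le_rpow`.
  refine ⟨RainbowMatching.rainbowProgram, 6000, fun n G hG φ L => ?_⟩
  obtain ⟨s, t, hrun, ht, M, hM, hout, hind, hmax⟩ :=
    RainbowMatching.rainbowProgram_spec (L.meet_trans φ hG) (L.input φ)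
      (by simp [RainbowMatching.EdgeListing.input])
      (fun i hi => by
        have h0 : i ≠ 0 := by omega
        have h1 : i ≠ 1 := by omega
        simp [RainbowMatching.EdgeListing.input, h0, h1])
      rfl rfl rfl
      (fun i hi => by
        have h0 : i ≠ 0 := by omega
        have h1 : i ≠ 1 := by omega
        have h2 : i ≠ 2 := by omega
        funext j
        simp [RainbowMatching.EdgeListing.input, h0, h1, h2])
  refine ⟨s, t, hrun, ⟨L.subgraph M, ⟨?_, fun M' hM' => ?_⟩, ?_⟩, ?_⟩
  · refine (L.isRainbowMatching_iff φ _ hM (fun i => L.edge_mem_subgraph) ?_).2 hind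
    rintro v ⟨i, h1, h2⟩
    obtain ⟨w, h3⟩ := Sym2.mem_iff_exists.1 h2
    exact ⟨w, i, h1, h3⟩
  · classical
    -- A competing matching is translated into the set of its edge numbers, to which the maximality
    -- `hmax` applies.
    have hS : ∀ i : Fin G.edgeSet.ncard, (L.edge i : Sym2 (Fin n)) ∈ M'.edgeSet ↔
        (i : ℕ) + 1 ∈ (Finset.univ.filter fun i => (L.edge i : Sym2 (Fin n)) ∈ M'.edgeSet).image
          fun i : Fin G.edgeSet.ncard => (i : ℕ) + 1 := by
      simp [Fin.val_inj]
    have hS' : ((Finset.univ.filter fun i => (L.edge i : Sym2 (Fin n)) ∈ M'.edgeSet).image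
        fun i : Fin G.edgeSet.ncard => (i : ℕ) + 1) ⊆ Finset.Icc 1 G.edgeSet.ncard := by
      intro r hr
      obtain ⟨i, -, rfl⟩ := Finset.mem_image.1 hr
      have := i.2
      simp only [Finset.mem_Icc]
      omega
    rw [L.ncard_edgeSet M' hS' hS, L.ncard_edgeSet _ hM fun i => L.edge_mem_subgraph]
    refine hmax _ hS' ((L.isRainbowMatching_iff φ _ hS' hS fun v hv => ?_).1 hM')
    obtain ⟨w, hw, -⟩ := hM'.1 hv
    exact ⟨w, hw⟩
  · ext e
    rw [L.mem_edgeSet_subgraph]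
    refine exists_congr fun i => and_congr_left fun _ => ?_
    have := hout (i + 1) (by omega) (by have := i.2; omega)
    simpa using this.symm
  · have h1 : (t : ℝ) ≤ ((1500 * ((G.edgeSet.ncard + 1) * (Nat.sqrt G.edgeSet.ncard + 1)) : ℕ) : ℝ) := by
      exact_mod_cast ht.trans_eq (by ring)
    have h2 := RainbowMatching.mul_sqrt_le_rpow G.edgeSet.ncard
    push_cast at h1 h2 ⊢
    linarith
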